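/- **Definitions.** A *precontraction group* is a totally ordered abelian group $\Gamma$ with a map $\chi:\Gamma\to\Gamma$ such that for all $a,b\in\Gamma$: (i) $\chi(a)=0\leftrightarrow a=0$; (ii) $a\le b\rightarrow\chi(a)\le\chi(b)$; (iii) $\chi(-a)=-\chi(a)$; (iv) if $a,b$ are archimedean equivalent (that is, $|a|\le n|b|$ and $|b|\le n|a|$ for some $n\ge 1$) and have the same sign, then $\chi(a)=\chi(b)$. It is *centripetal* if $|\chi(a)|<|a|$ for all $a\ne 0$. Let $L_{pdg}=\{+,-,0,<,\chi,c\}$ be the language of ordered groups with a unary function symbol $\chi$ and a constant symbol $c$, and let $T_{pdg}$ be the first-order $L_{pdg}$-theory whose models are the nontrivial centripetal precontraction groups $(\Gamma,\chi)$ such that, with $\Gamma^{<0}=\{a\in\Gamma:a<0\}$, 1. $c$ is the least element of $\chi(\Gamma^{<0})$; 2. $\chi$ restricts to a bijection $\chi(\Gamma^{<0})\to\{b\in\chi(\Gamma^{<0}):b>c\}$; 3. for all $a,b\in\chi(\Gamma^{<0})$, if $a<b$ then $a<\chi(a)\le b$; 4. $\Gamma$ is divisible. **Theorem.** (a) Let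 $\Gamma\subsetneq\Gamma'$ be models of $T_{pdg}$ ($\Gamma$ a proper $L_{pdg}$-substructure of $\Gamma'$), and let $\Gamma^*$ be a $\kappa$-saturated elementary extension of $\Gamma$, where $\kappa>|\Gamma'|$. Then there is a substructure $\Delta$ of $\Gamma'$ that is a model of $T_{pdg}$ and properly extends $\Gamma$ (possibly $\Delta=\Gamma'$), together with an $L_{pdg}$-embedding of $\Delta$ into $\Gamma^*$ which is the identity on $\Gamma$. (b) $T_{pdg}$ is model complete: whenever $M\subseteq N$ are models of $T_{pdg}$, $M$ is an elementary substructure of $N$. -/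

import Mathlib

open FirstOrder FirstOrder.Language Cardinal

universe u v w x y

namespace Pdg

/-- Function symbols of the language of precontraction groups: `0`, `-`, `+`, the unary symbol `χ`
and the constant symbol `c`. -/
inductive Func : ℕ → Type
  | zero : Func 0
  | neg : Func 1
  | add : Func 2
  | chi : Func 1
  | c : Func 0

/-- The only relation symbol is the binary symbol `<`. -/
inductive Rel : ℕ → Type
  | lt : Rel 2

/-- The language `{+, -, 0, <, χ, c}`. -/
def Lpdg : FirstOrder.Language.{0, 0} := ⟨Func, Rel⟩

section Syntax_building

variable {α : Type u}

instance : Zero (Lpdg.Term α) := ⟨Constants.term (L := Lpdg) Func.zero⟩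
instance : Neg (Lpdg.Term α) := ⟨Functions.apply₁ (L := Lpdg) Func.neg⟩
instance : Add (Lpdg.Term α) := ⟨Functions.apply₂ (L := Lpdg) Func.add⟩

/-- The term `χ(t)`. -/
def chi (t : Lpdg.Term α) : Lpdg.Term α := Functions.apply₁ (L := Lpdg) Func.chi t

/-- The constant `c` as a term. -/
def c : Lpdg.Term α := Constants.term (L := Lpdg) Func.c

/-- The term `t + ⋯ + t` with `k` summands. -/
def mul : ℕ → Lpdg.Term α → Lpdg.Term α
  | 0, _ => 0
  | k + 1, t => mul k t + t

variable {n : ℕ}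

/-- The `i`-th bound variable. -/
def v (i : Fin n) : Lpdg.Term (Empty ⊕ Fin n) := Term.var (Sum.inr i)

/-- The formula `s = t`. -/
def eq (s t : Lpdg.Term (Empty ⊕ Fin n)) : Lpdg.BoundedFormula Empty n := Term.bdEqual s t

/-- The formula `s < t`. -/
def lt (s t : Lpdg.Term (Empty ⊕ Fin n)) : Lpdg.BoundedFormula Empty n :=
  Relations.boundedFormula₂ (L := Lpdg) Rel.lt s t

/-- The formula `s ≤ t`. -/
def le (s t : Lpdg.Term (Empty ⊕ Fin n)) : Lpdg.BoundedFormula Empty n :=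
  lt s t ⊔ eq s t

/-- The formula `|s| < |t|`, where `|z| = max {z, -z}`. -/
def absLt (s t : Lpdg.Term (Empty ⊕ Fin n)) : Lpdg.BoundedFormula Empty n :=
  (lt s t ⊔ lt s (-t)) ⊓ (lt (-s) t ⊔ lt (-s) (-t))

/-- The formula `|s| ≤ |t|`, where `|z| = max {z, -z}`. -/
def absLe (s t : Lpdg.Term (Empty ⊕ Fin n)) : Lpdg.BoundedFormula Empty n :=
  (le s t ⊔ le s (-t)) ⊓ (le (-s) t ⊔ le (-s) (-t))

/-- The formula `sign s = sign t`. -/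
def sameSign (s t : Lpdg.Term (Empty ⊕ Fin n)) : Lpdg.BoundedFormula Empty n :=
  (lt 0 s ⊓ lt 0 t) ⊔ (eq s 0 ⊓ eq t 0) ⊔ (lt s 0 ⊓ lt t 0)

/-- The formula saying that the `i`-th variable lies in `χ(Γ^{<0})`:
there is `z < 0` with `χ(z)` equal to that variable. -/
def inImage (i : Fin n) : Lpdg.BoundedFormula Empty n :=
  (lt (v (Fin.last n)) 0 ⊓ eq (chi (v (Fin.last n))) (v i.castSucc)).ex

/-- Universal closure in one variable. -/
def all₁ (φ : Lpdg.BoundedFormula Empty 1) : Lpdg.Sentence := φ.all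

/-- Universal closure in two variables. -/
def all₂ (φ : Lpdg.BoundedFormula Empty 2) : Lpdg.Sentence := φ.all.all

/-- Universal closure in three variables. -/
def all₃ (φ : Lpdg.BoundedFormula Empty 3) : Lpdg.Sentence := φ.all.all.all

/-- Existential closure in one variable. -/
def ex₁ (φ : Lpdg.BoundedFormula Empty 1) : Lpdg.Sentence := φ.ex

end Syntax_building

/-! Axioms of nontrivial ordered abelian groups. -/

def addAssoc : Lpdg.Sentence := all₃ (eq ((v 0 + v 1) + v 2) (v 0 + (v 1 + v 2)))

def addComm : Lpdg.Sentence := all₂ (eq (v 0 + v 1) (v 1 + v 0))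

def addZero : Lpdg.Sentence := all₁ (eq (v 0 + 0) (v 0))

def addNeg : Lpdg.Sentence := all₁ (eq (v 0 + -(v 0)) 0)

def ltIrrefl : Lpdg.Sentence := all₁ (∼(lt (v 0) (v 0)))

def ltTrans : Lpdg.Sentence :=
  all₃ ((lt (v 0) (v 1) ⊓ lt (v 1) (v 2)) ⟹ lt (v 0) (v 2))

def ltTotal : Lpdg.Sentence :=
  all₂ (lt (v 0) (v 1) ⊔ eq (v 0) (v 1) ⊔ lt (v 1) (v 0))

def addLt : Lpdg.Sentence :=
  all₃ (lt (v 0) (v 1) ⟹ lt (v 0 + v 2) (v 1 + v 2))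

def nontriv : Lpdg.Sentence := ex₁ (∼(eq (v 0) 0))

/-! Axioms of centripetal precontraction groups. -/

/-- `χ(a) = 0 ↔ a = 0`. -/
def chiZero : Lpdg.Sentence := all₁ ((eq (chi (v 0)) 0).iff (eq (v 0) 0))

/-- `a ≤ b → χ(a) ≤ χ(b)`. -/
def chiMono : Lpdg.Sentence := all₂ (le (v 0) (v 1) ⟹ le (chi (v 0)) (chi (v 1)))

/-- `χ(-a) = -χ(a)`. -/
def chiNeg : Lpdg.Sentence := all₁ (eq (chi (-(v 0))) (-(chi (v 0))))

/-- If `sign a = sign b`, `|a| ≤ k|b|` and `|b| ≤ k|a|`, then `χ(a) = χ(b)`. For all `k ≥ 1`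
together: archimedean equivalent elements of the same sign have the same image. -/
def chiArch (k : ℕ) : Lpdg.Sentence :=
  all₂ ((sameSign (v 0) (v 1) ⊓ absLe (v 0) (mul k (v 1)) ⊓ absLe (v 1) (mul k (v 0))) ⟹
    eq (chi (v 0)) (chi (v 1)))

/-- `a ≠ 0 → |χ(a)| < |a|`. -/
def centripetal : Lpdg.Sentence := all₁ (∼(eq (v 0) 0) ⟹ absLt (chi (v 0)) (v 0))

/-! The remaining axioms. -/

/-- `c` is an element of `χ(Γ^{<0})`. -/
def cMem : Lpdg.Sentence := ex₁ (lt (v 0) 0 ⊓ eq (chi (v 0)) c)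

/-- `c` is a lower bound of `χ(Γ^{<0})`. -/
def cLeast : Lpdg.Sentence := all₁ (inImage 0 ⟹ le c (v 0))

/-- `χ` maps `χ(Γ^{<0})` into `χ(Γ^{<0})^{>c}`. -/
def chiMapsTo : Lpdg.Sentence :=
  all₁ (inImage 0 ⟹
    ((lt (v 1) 0 ⊓ eq (chi (v 1)) (chi (v 0))).ex ⊓ lt c (chi (v 0))))

/-- `χ` is injective on `χ(Γ^{<0})`. -/
def chiInj : Lpdg.Sentence :=
  all₂ ((inImage 0 ⊓ inImage 1 ⊓ eq (chi (v 0)) (chi (v 1))) ⟹ eq (v 0) (v 1))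

/-- Every element of `χ(Γ^{<0})^{>c}` is the image under `χ` of an element of `χ(Γ^{<0})`. -/
def chiSurj : Lpdg.Sentence :=
  all₁ ((inImage 0 ⊓ lt c (v 0)) ⟹ (inImage 1 ⊓ eq (chi (v 1)) (v 0)).ex)

/-- For `a, b ∈ χ(Γ^{<0})`, if `a < b` then `a < χ(a) ≤ b`. -/
def chiSucc : Lpdg.Sentence :=
  all₂ ((inImage 0 ⊓ inImage 1 ⊓ lt (v 0) (v 1)) ⟹
    (lt (v 0) (chi (v 0)) ⊓ le (chi (v 0)) (v 1)))

/-- Every element is divisible by `k`. -/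
def divisible (k : ℕ) : Lpdg.Sentence := all₁ (eq (mul k (v 1)) (v 0)).ex

/-- The theory of nontrivial divisible centripetal precontraction groups `(Γ, χ)` such that
`χ(Γ^{<0})` has the least element `c` and `χ` is the successor map of `χ(Γ^{<0})`, a bijection of
`χ(Γ^{<0})` onto `χ(Γ^{<0})^{>c}`. -/
def Tpdg : Lpdg.Theory :=
  {addAssoc, addComm, addZero, addNeg, ltIrrefl, ltTrans, ltTotal, addLt, nontriv,
    chiZero, chiMono, chiNeg, centripetal,
    cMem, cLeast, chiMapsTo, chiInj, chiSurj, chiSucc} ∪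
  {φ | ∃ k : ℕ, 1 ≤ k ∧ φ = chiArch k} ∪
  {φ | ∃ k : ℕ, 1 ≤ k ∧ φ = divisible k}

/-- `M` is `κ`-saturated: for every `A ⊆ M` with fewer than `κ` elements, every set of formulas in
one variable with parameters from `A` that is finitely satisfiable in `M` is realized in `M`. -/
def IsSaturated (L : FirstOrder.Language.{x, y}) (κ : Cardinal.{w}) (M : Type w) [L.Structure M] : Prop :=
  ∀ A : Set M, #A < κ → ∀ p : Set (L[[A]].Formula Unit),
    (∀ F : Finset (L[[A]].Formula Unit), ↑F ⊆ p →
      ∃ a : M, ∀ φ ∈ F, φ.Realize (fun _ => a)) →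
    ∃ a : M, ∀ φ ∈ p, φ.Realize (fun _ => a)

/-- A theory is model complete if every embedding between models of it is elementary
(equivalently, if `M ⊆ N` for models `M`, `N` implies that `M` is an elementary substructure
of `N`). -/
def IsModelComplete {L : FirstOrder.Language.{x, y}} (T : L.Theory) : Prop :=
  ∀ (M : Type u) (N : Type v) [L.Structure M] [L.Structure N] [Nonempty M] [Nonempty N],
    M ⊨ T → N ⊨ T → ∀ f : M ↪[L] N, ∀ (n : ℕ) (φ : L.Formula (Fin n)) (a : Fin n → M),
      φ.Realize (f ∘ a) ↔ φ.Realize a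

end Pdg

/-! Write Ψ for the image of the negative cone under χ. The proof extends partial isomorphisms:
subgroups `H` of `G × G'` that are graphs of isomorphisms between submodels. When `G'` is saturated
enough, such an `H` can be extended to reach any element of `G`, in one of two ways.

If some `e` in Ψ lies outside the domain, saturation gives an element of Ψ in `G'` in the
corresponding cut, and the two ℤ-orbits under χ are added together. Their members have archimedean
classes that are pairwise distinct and new to `H`, so every nonzero combination has a dominant term
(`IsChain.exists_dominant`), which determines its sign and its image under χ.

If Ψ lies in the domain, so does every `χ(d + h)`. Since sign is visible in χ, adding `d` only
requires some `d'` with the corresponding values `χ(d' + h')`. The fibres of `z ↦ χ(z + a)` are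
convex, so by Helly's theorem finite satisfiability reduces to two conditions at a time, and these
are solved inside the domain (`exists_approx`).

Zorn's lemma then gives `IsPartialIso.exists_total_extension`, which proves (a) with Δ the whole of
Γ'. For (b), ultrapowers over ℕ realize the relevant countable types, so countable partial
isomorphisms between them go back and forth and preserve all formulas
(`realize_iff_of_isPartialIso`). A countable elementary substructure of `M` containing a given tuple
embeds in the ultrapowers of both `M` and `N`, and pairing the two embeddings gives the partial
isomorphism needed. -/

/-- A divisible centripetal precontraction group in which `χ` is the successor map of the image
of the negative cone, whose least element is `c`. -/
class PdgGroup (G : Type*) extends AddCommGroup G, LinearOrder G, IsOrderedAddMonoid G where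
  /-- The precontraction map. -/
  chi : G → G
  /-- The least element of the image of the negative cone. -/
  c : G
  chi_eq_zero : ∀ a, chi a = 0 ↔ a = 0
  chi_mono : ∀ a b, a ≤ b → chi a ≤ chi b
  chi_neg : ∀ a, chi (-a) = -chi a
  chi_eq_of_le_nsmul : ∀ (k : ℕ) (a b : G), 0 < a → 0 < b → a ≤ k • b → b ≤ k • a → chi a = chi b
  lt_chi : ∀ a, a < 0 → a < chi a
  exists_chi_eq_c : ∃ z, z < 0 ∧ chi z = c
  c_le_chi : ∀ z, z < 0 → c ≤ chi z
  c_lt_chi_chi : ∀ z, z < 0 → c < chi (chi z)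
  chi_chi_injOn : ∀ a b, a < 0 → b < 0 → chi (chi a) = chi (chi b) → chi a = chi b
  exists_chi_chi : ∀ z, z < 0 → c < chi z → ∃ a, a < 0 ∧ chi (chi a) = chi z
  chi_chi_le : ∀ a b, a < 0 → b < 0 → chi a < chi b → chi (chi a) ≤ chi b
  exists_nsmul_eq : ∀ (n : ℕ) (a : G), n ≠ 0 → ∃ b, n • b = a

/-! ### χ and archimedean classes -/

namespace PdgGroup

section Basic

variable {G : Type*} [PdgGroup G]

variable (G) in
/-- The image of the negative cone under `χ`. -/
def Psi : Set G := {b | ∃ z, z < 0 ∧ chi z = b}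

@[simp] lemma chi_zero : chi (0 : G) = 0 := (chi_eq_zero 0).2 rfl

lemma monotone_chi : Monotone (chi : G → G) := fun a b h => chi_mono a b h

lemma lt_of_chi_lt {a b : G} (h : chi a < chi b) : a < b := monotone_chi.reflect_lt h

lemma chi_neg_iff {a : G} : chi a < 0 ↔ a < 0 := by
  constructor
  · intro h
    exact lt_of_chi_lt (by simpa using h)
  · intro h
    refine lt_of_le_of_ne ?_ fun h0 => h.ne ((chi_eq_zero a).1 h0)
    simpa using monotone_chi h.le

lemma chi_pos_iff {a : G} : 0 < chi a ↔ 0 < a := by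
  have := chi_neg_iff (a := -a)
  simpa [chi_neg] using this

lemma chi_abs (a : G) : chi |a| = |chi a| := by
  rcases le_total 0 a with h | h
  · rw [abs_of_nonneg h, abs_of_nonneg (by simpa using monotone_chi h)]
  · rw [abs_of_nonpos h, abs_of_nonpos (by simpa using monotone_chi h), chi_neg]

lemma chi_mem_Psi {a : G} (h : a < 0) : chi a ∈ Psi G := ⟨a, h, rfl⟩

lemma neg_of_mem_Psi {a : G} (h : a ∈ Psi G) : a < 0 := by
  obtain ⟨z, hz, rfl⟩ := h
  exact chi_neg_iff.2 hz

lemma c_mem_Psi : (c : G) ∈ Psi G := exists_chi_eq_c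

lemma c_neg : (c : G) < 0 := neg_of_mem_Psi c_mem_Psi

lemma c_le_of_mem_Psi {a : G} (h : a ∈ Psi G) : c ≤ a := by
  obtain ⟨z, hz, rfl⟩ := h
  exact c_le_chi z hz

lemma c_lt_chi {a : G} (h : a ∈ Psi G) : c < chi a := by
  obtain ⟨z, hz, rfl⟩ := h
  exact c_lt_chi_chi z hz

lemma injOn_chi_Psi : Set.InjOn (chi : G → G) (Psi G) := by
  rintro _ ⟨a, ha, rfl⟩ _ ⟨b, hb, rfl⟩ h
  exact chi_chi_injOn a b ha hb h

lemma exists_pred {a : G} (h : a ∈ Psi G) (hc : a ≠ c) : ∃ b ∈ Psi G, chi b = a := by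
  have hlt : c < a := lt_of_le_of_ne (c_le_of_mem_Psi h) hc.symm
  obtain ⟨z, hz, rfl⟩ := h
  obtain ⟨b, hb, h⟩ := exists_chi_chi z hz hlt
  exact ⟨chi b, chi_mem_Psi hb, h⟩

lemma chi_le_of_lt {a b : G} (ha : a ∈ Psi G) (hb : b ∈ Psi G) (h : a < b) : chi a ≤ b := by
  obtain ⟨a, ha, rfl⟩ := ha
  obtain ⟨b, hb, rfl⟩ := hb
  exact chi_chi_le a b ha hb h

lemma chi_lt_chi {a b : G} (ha : a ∈ Psi G) (hb : b ∈ Psi G) (h : a < b) : chi a < chi b :=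
  lt_of_le_of_ne (monotone_chi h.le) fun e => h.ne (injOn_chi_Psi ha hb e)

/-- Axiom (iv) in terms of archimedean classes. Comparing negativity is enough, because 0 is alone
in its class. -/
lemma chi_eq_of_mk_eq {a b : G} (h : ArchimedeanClass.mk a = ArchimedeanClass.mk b)
    (hs : a < 0 ↔ b < 0) : chi a = chi b := by
  have key : ∀ a b : G, ArchimedeanClass.mk a = ArchimedeanClass.mk b → 0 < a → 0 < b →
      chi a = chi b := by
    intro a b h ha hb
    obtain ⟨⟨m, hm⟩, n, hn⟩ := ArchimedeanClass.mk_eq_mk.1 h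
    rw [abs_of_pos ha, abs_of_pos hb] at hm hn
    exact chi_eq_of_le_nsmul (max m n) a b ha hb
      (hn.trans (nsmul_le_nsmul_left hb.le (le_max_right _ _)))
      (hm.trans (nsmul_le_nsmul_left ha.le (le_max_left _ _)))
  by_cases ha : a = 0
  · subst ha
    rw [ArchimedeanClass.mk_zero, ArchimedeanClass.top_eq_mk_iff] at h
    rw [h]
  by_cases hb : b = 0
  · subst hb
    rw [ArchimedeanClass.mk_zero, ArchimedeanClass.mk_eq_top_iff] at h
    rw [h]
  rcases lt_or_gt_of_ne ha with ha' | ha'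
  · have := key (-a) (-b) (by simpa using h) (by simpa using ha') (by simpa using hs.1 ha')
    simpa [chi_neg] using this
  · refine key a b h ha' (lt_of_le_of_ne ?_ (Ne.symm hb))
    exact not_lt.1 fun h => ha'.not_gt (hs.2 h)

/-- The order of classes is reversed: larger absolute values have smaller classes. Here `a < b < 0`,
and equivalent negative elements would have equal images. -/
lemma mk_lt_mk_of_chi_lt {a b : G} (hb : b < 0) (h : chi a < chi b) :
    ArchimedeanClass.mk a < ArchimedeanClass.mk b := by
  have hlt := lt_of_chi_lt h
  refine lt_of_le_of_ne (ArchimedeanClass.mk_le_mk_of_abs ?_) fun e =>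
    h.ne (chi_eq_of_mk_eq e ⟨fun _ => hb, fun _ => hlt.trans hb⟩)
  rw [abs_of_neg hb, abs_of_neg (hlt.trans hb)]
  exact neg_le_neg hlt.le

lemma mk_lt_mk_of_abs_chi_lt {a b : G} (h : |chi b| < |chi a|) :
    ArchimedeanClass.mk a < ArchimedeanClass.mk b := by
  rw [← chi_abs, ← chi_abs] at h
  have hlt := lt_of_chi_lt h
  refine lt_of_le_of_ne (ArchimedeanClass.mk_le_mk_of_abs hlt.le) fun e => h.ne ?_
  exact chi_eq_of_mk_eq (by simpa using e.symm)
    (iff_of_false (abs_nonneg b).not_gt (abs_nonneg a).not_gt)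

/-- Adding an element of a smaller archimedean class does not change the sign. -/
lemma neg_iff_of_mk_lt {a b : G}
    (h : ArchimedeanClass.mk b < ArchimedeanClass.mk (a - b)) : a < 0 ↔ b < 0 := by
  rw [ArchimedeanClass.mk_lt_mk] at h
  have h1 := h 1
  rw [one_nsmul] at h1
  rcases lt_trichotomy b 0 with hb | hb | hb
  · rw [abs_of_neg hb, abs_lt] at h1
    simp only [hb, iff_true]
    have := h1.2
    rw [sub_lt_iff_lt_add] at this
    simpa using this
  · subst hb
    simp only [abs_zero] at h1
    exact absurd h1 (not_lt.2 (abs_nonneg _))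
  · rw [abs_of_pos hb, abs_lt] at h1
    simp only [hb.not_gt, iff_false, not_lt]
    have := h1.1
    rw [lt_sub_iff_add_lt] at this
    simpa using this.le

lemma mk_eq_of_mk_lt {a b : G}
    (h : ArchimedeanClass.mk b < ArchimedeanClass.mk (a - b)) :
    ArchimedeanClass.mk a = ArchimedeanClass.mk b := by
  have := ArchimedeanClass.mk_add_eq_mk_left h
  rwa [add_sub_cancel] at this

/-- Here `b` is the dominant term of `a`; the remainder `a - b` affects neither class nor sign. -/
lemma chi_eq_of_mk_lt {a b : G}
    (h : ArchimedeanClass.mk b < ArchimedeanClass.mk (a - b)) : chi a = chi b :=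
  chi_eq_of_mk_eq (mk_eq_of_mk_lt h) (neg_iff_of_mk_lt h)

lemma chi_add_of_abs_chi_lt {a b : G} (h : |chi b| < |chi a|) : chi (a + b) = chi a :=
  chi_eq_of_mk_lt (by simpa using mk_lt_mk_of_abs_chi_lt h)

lemma mk_nsmul {n : ℕ} (hn : n ≠ 0) (a : G) :
    ArchimedeanClass.mk (n • a) = ArchimedeanClass.mk a := by
  refine ArchimedeanClass.mk_eq_mk.2 ⟨⟨1, ?_⟩, n, ?_⟩
  · rw [one_nsmul, abs_nsmul]
    simpa using nsmul_le_nsmul_left (abs_nonneg a) (Nat.one_le_iff_ne_zero.2 hn)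
  · rw [abs_nsmul]

lemma nsmul_neg_iff' {n : ℕ} (hn : n ≠ 0) {a : G} : n • a < 0 ↔ a < 0 := by
  constructor
  · intro h
    by_contra h'
    exact h.not_ge (nsmul_nonneg (not_lt.1 h') n)
  · exact fun h => nsmul_neg h hn

lemma chi_nsmul {n : ℕ} (hn : n ≠ 0) (a : G) : chi (n • a) = chi a :=
  chi_eq_of_mk_eq (mk_nsmul hn a) (nsmul_neg_iff' hn)

lemma infinite : Infinite G := by
  have h : StrictAnti fun n : ℕ => n • (c : G) := by
    refine strictAnti_nat_of_succ_lt fun n => ?_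
    rw [succ_nsmul]
    simpa using c_neg
  exact Infinite.of_injective _ h.injective

end Basic

end PdgGroup

/-! ### Partial isomorphisms -/

namespace PdgGroup

section PartialIso

variable {G G' : Type*} [PdgGroup G] [PdgGroup G']

/-- The graph of an isomorphism between submodels of `G` and `G'`. -/
structure IsPartialIso (H : AddSubgroup (G × G')) : Prop where
  neg_iff : ∀ p ∈ H, p.1 < 0 ↔ p.2 < 0
  chi_mem : ∀ p ∈ H, (chi p.1, chi p.2) ∈ H
  exists_chi_eq_c : ∃ p ∈ H, p.1 < 0 ∧ chi p.1 = c ∧ chi p.2 = c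
  mem_of_nsmul_mem : ∀ (n : ℕ) (p : G × G'), n ≠ 0 → n • p ∈ H → p ∈ H
  exists_pred : ∀ p ∈ H, p.1 ∈ Psi G → p.2 ∈ Psi G' → p.1 ≠ c →
    ∃ q ∈ H, q.1 ∈ Psi G ∧ q.2 ∈ Psi G' ∧ chi q.1 = p.1 ∧ chi q.2 = p.2

namespace IsPartialIso

variable {H : AddSubgroup (G × G')}

lemma lt_iff (hH : IsPartialIso H) {p q : G × G'} (hp : p ∈ H) (hq : q ∈ H) :
    p.1 < q.1 ↔ p.2 < q.2 := by
  have := hH.neg_iff (p - q) (H.sub_mem hp hq)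
  simpa using this

lemma le_iff (hH : IsPartialIso H) {p q : G × G'} (hp : p ∈ H) (hq : q ∈ H) :
    p.1 ≤ q.1 ↔ p.2 ≤ q.2 := by
  rw [← not_lt, ← not_lt, hH.lt_iff hq hp]

lemma fst_eq_iff (hH : IsPartialIso H) {p q : G × G'} (hp : p ∈ H) (hq : q ∈ H) :
    p.1 = q.1 ↔ p.2 = q.2 := by
  rw [le_antisymm_iff, le_antisymm_iff, hH.le_iff hp hq, hH.le_iff hq hp]

lemma eq_of_fst_eq (hH : IsPartialIso H) {p q : G × G'} (hp : p ∈ H) (hq : q ∈ H)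
    (h : p.1 = q.1) : p = q :=
  Prod.ext h ((hH.fst_eq_iff hp hq).1 h)

lemma eq_of_snd_eq (hH : IsPartialIso H) {p q : G × G'} (hp : p ∈ H) (hq : q ∈ H)
    (h : p.2 = q.2) : p = q :=
  Prod.ext ((hH.fst_eq_iff hp hq).2 h) h

lemma c_mem (hH : IsPartialIso H) : ((c, c) : G × G') ∈ H := by
  obtain ⟨p, hp, -, h1, h2⟩ := hH.exists_chi_eq_c
  simpa [h1, h2] using hH.chi_mem p hp

/-- `H` contains the predecessor of `(chi p.1, chi p.2)`, and injectivity of χ on Ψ identifies it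
with `q`. -/
lemma mem_of_chi_eq (hH : IsPartialIso H) {p q : G × G'} (hp : p ∈ H) (h1 : q.1 ∈ Psi G)
    (h2 : q.2 ∈ Psi G') (e1 : chi q.1 = chi p.1) (e2 : chi q.2 = chi p.2) : q ∈ H := by
  have hn : p.1 < 0 := chi_neg_iff.1 (e1 ▸ chi_neg_iff.2 (neg_of_mem_Psi h1))
  obtain ⟨r, hr, hr1, hr2, er1, er2⟩ := hH.exists_pred _ (hH.chi_mem p hp) (chi_mem_Psi hn)
    (chi_mem_Psi ((hH.neg_iff p hp).1 hn)) (e1 ▸ (c_lt_chi h1).ne')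
  have : q = r := Prod.ext (injOn_chi_Psi h1 hr1 (e1.trans er1.symm))
    (injOn_chi_Psi h2 hr2 (e2.trans er2.symm))
  rwa [this]

lemma exists_of_chi_eq (hH : IsPartialIso H) {p : G × G'} (hp : p ∈ H) {a : G}
    (ha : a ∈ Psi G) (e : chi a = chi p.1) : ∃ q ∈ H, q.1 = a ∧ q.2 ∈ Psi G' := by
  have hn : p.1 < 0 := chi_neg_iff.1 (e ▸ chi_neg_iff.2 (neg_of_mem_Psi ha))
  obtain ⟨r, hr, hr1, hr2, er1, er2⟩ := hH.exists_pred _ (hH.chi_mem p hp) (chi_mem_Psi hn)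
    (chi_mem_Psi ((hH.neg_iff p hp).1 hn)) (e ▸ (c_lt_chi ha).ne')
  exact ⟨r, hr, injOn_chi_Psi hr1 ha (er1.trans e.symm), hr2⟩

/-- Membership in Ψ transfers because an element of Ψ is the unique predecessor in Ψ of its image,
and predecessors come in pairs in `H`. -/
lemma snd_mem_Psi (hH : IsPartialIso H) {p : G × G'} (hp : p ∈ H) (h : p.1 ∈ Psi G) :
    p.2 ∈ Psi G' := by
  obtain ⟨q, hq, e, h2⟩ := hH.exists_of_chi_eq hp h rfl
  rwa [← hH.eq_of_fst_eq hq hp e]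

lemma symm (hH : IsPartialIso H) :
    IsPartialIso (H.comap (AddEquiv.prodComm : G' × G ≃+ G × G').toAddMonoidHom) where
  neg_iff p hp := (hH.neg_iff p.swap hp).symm
  chi_mem p hp := hH.chi_mem p.swap hp
  exists_chi_eq_c := by
    obtain ⟨p, hp, h, h1, h2⟩ := hH.exists_chi_eq_c
    exact ⟨p.swap, hp, (hH.neg_iff p hp).1 h, h2, h1⟩
  mem_of_nsmul_mem n p hn hp := hH.mem_of_nsmul_mem n p.swap hn hp
  exists_pred p hp h1 h2 h := by
    obtain ⟨q, hq, hq1, hq2, e1, e2⟩ := hH.exists_pred p.swap hp h2 h1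
      fun e => h ((hH.fst_eq_iff hp hH.c_mem).1 e)
    exact ⟨q.swap, hq, hq2, hq1, e2, e1⟩

end IsPartialIso

/-- The elements with a nonzero multiple in a given subgroup. -/
def pureClosure {A : Type*} [AddCommGroup A] (S : AddSubgroup A) : AddSubgroup A where
  carrier := {p | ∃ n : ℕ, n ≠ 0 ∧ n • p ∈ S}
  zero_mem' := ⟨1, one_ne_zero, by simp⟩
  add_mem' := by
    rintro a b ⟨m, hm, ha⟩ ⟨n, hn, hb⟩
    refine ⟨m * n, mul_ne_zero hm hn, ?_⟩
    rw [nsmul_add]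
    refine S.add_mem ?_ ?_
    · rw [mul_nsmul]
      exact S.nsmul_mem ha n
    · rw [mul_comm, mul_nsmul]
      exact S.nsmul_mem hb m
  neg_mem' := by
    rintro a ⟨m, hm, ha⟩
    exact ⟨m, hm, by simpa using ha⟩

lemma le_pureClosure {A : Type*} [AddCommGroup A] (S : AddSubgroup A) : S ≤ pureClosure S :=
  fun p hp => ⟨1, one_ne_zero, by simpa using hp⟩

/-- A criterion for the pure closure of an extension of a partial isomorphism. -/
lemma IsPartialIso.pureClosure {H S : AddSubgroup (G × G')} (hH : IsPartialIso H) (hS : H ≤ S)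
    (hneg : ∀ p ∈ S, p.1 < 0 ↔ p.2 < 0) (hchi : ∀ p ∈ S, (chi p.1, chi p.2) ∈ S)
    (hpred : ∀ p ∈ PdgGroup.pureClosure S, p.1 ∈ Psi G → p.2 ∈ Psi G' → p ∈ H ∨
      ∃ q ∈ S, q.1 ∈ Psi G ∧ q.2 ∈ Psi G' ∧ chi q.1 = p.1 ∧ chi q.2 = p.2) :
    IsPartialIso (PdgGroup.pureClosure S) where
  neg_iff p := by
    -- A positive multiple has the same sign and the same image under χ, so only predecessors need
    -- an assumption on the closure itself.
    rintro ⟨n, hn, hp⟩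
    rw [← nsmul_neg_iff' hn, ← nsmul_neg_iff' hn (a := p.2)]
    exact hneg _ hp
  chi_mem p := by
    rintro ⟨n, hn, hp⟩
    rw [← chi_nsmul hn, ← chi_nsmul hn p.2]
    exact le_pureClosure S (hchi _ hp)
  exists_chi_eq_c := by
    obtain ⟨p, hp, h⟩ := hH.exists_chi_eq_c
    exact ⟨p, le_pureClosure S (hS hp), h⟩
  mem_of_nsmul_mem n p hn := by
    rintro ⟨m, hm, hp⟩
    exact ⟨n * m, mul_ne_zero hn hm, by rwa [mul_nsmul]⟩
  exists_pred p hp h1 h2 hc := by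
    rcases hpred p hp h1 h2 with h | ⟨q, hq, h⟩
    · obtain ⟨q, hq, h⟩ := hH.exists_pred p h h1 h2 hc
      exact ⟨q, le_pureClosure S (hS hq), h⟩
    · exact ⟨q, le_pureClosure S hq, h⟩

end PartialIso

end PdgGroup

/-! ### Extension by an arbitrary element once Ψ lies in the domain -/

namespace PdgGroup

/-- Helly's theorem for convex subsets of a linear order. -/
lemma exists_mem_of_pairwise {α ι : Type*} [LinearOrder α] {F : Finset ι} (hF : F.Nonempty)
    {D : Set α} {C : ι → Set α} (hC : ∀ i, (C i).OrdConnected)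
    (h : ∀ i ∈ F, ∀ j ∈ F, ∃ z ∈ D, z ∈ C i ∧ z ∈ C j) : ∃ z ∈ D, ∀ i ∈ F, z ∈ C i := by
  obtain ⟨i₁, hi₁⟩ := hF
  have : Nonempty α := ⟨(h i₁ hi₁ i₁ hi₁).choose⟩
  have : Nonempty ι := ⟨i₁⟩
  choose! X hD h1 h2 using h
  have hmin : ∀ i, ∃ j ∈ F, ∀ k ∈ F, X i j ≤ X i k := fun i =>
    F.exists_min_image (X i) ⟨i₁, hi₁⟩
  choose m hm hle using hmin
  obtain ⟨i, hi, hmax⟩ := F.exists_max_image (fun i => X i (m i)) ⟨i₁, hi₁⟩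
  -- The max-min of the chosen points lies between `X k (m k)` and `X i k`, both in `C k`.
  exact ⟨X i (m i), hD i hi _ (hm i), fun k hk =>
    (hC k).out (h1 k hk _ (hm k)) (h2 i hi k hk) ⟨hmax k hk, hle i k hk⟩⟩

section Approx

variable {G : Type*} [PdgGroup G]

lemma ordConnected_chi_fiber (a b : G) : {z : G | chi (z + a) = b}.OrdConnected := by
  refine ⟨fun s (hs : chi (s + a) = b) t (ht : chi (t + a) = b) z hz => le_antisymm ?_ ?_⟩
  · rw [← ht]
    exact monotone_chi (by simpa using hz.2)
  · rw [← hs]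
    exact monotone_chi (by simpa using hz.1)

lemma chi_add_ne_neg {d a : G} (ha : a ≠ 0) (h : chi d = chi a) : chi (d + a) ≠ -chi a := by
  intro e
  rcases lt_or_gt_of_ne ha with h0 | h0
  · have hd : d < 0 := chi_neg_iff.1 (h ▸ chi_neg_iff.2 h0)
    have h1 : chi (d + a) < 0 := chi_neg_iff.2 (add_neg hd h0)
    rw [e] at h1
    exact absurd (chi_neg_iff.2 h0) (by simpa using h1.le)
  · have hd : 0 < d := chi_pos_iff.1 (h ▸ chi_pos_iff.2 h0)
    have h1 : 0 < chi (d + a) := chi_pos_iff.2 (add_pos hd h0)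
    rw [e] at h1
    exact absurd (chi_pos_iff.2 h0) (by simpa using h1.le)

/-- If `d` and `a` have χ-values of different size, the larger term controls the sum and any `b` in
the fibre of `d` works. Otherwise cancellation in `d + a` has to be imitated inside `D`. -/
lemma exists_approx {D : AddSubgroup G} (hfib : ∀ z, ∃ a ∈ D, chi a = chi z)
    (hhalf : ∀ a ∈ D, ∃ b ∈ D, 2 • b = a) {d a : G} (ha : a ∈ D) (hd : d ∉ D) :
    ∃ b ∈ D, chi b = chi d ∧ chi (b + a) = chi (d + a) := by
  rcases lt_trichotomy |chi d| |chi a| with h | h | h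
  · obtain ⟨b, hb, e⟩ := hfib d
    refine ⟨b, hb, e, ?_⟩
    rw [add_comm b, add_comm d, chi_add_of_abs_chi_lt h, chi_add_of_abs_chi_lt (e ▸ h)]
  · rcases lt_trichotomy |chi (d + a)| |chi a| with h' | h' | h'
    -- Cancellation: choose the sum first, then subtract `a`, which dominates it.
    · obtain ⟨b, hb, e⟩ := hfib (d + a)
      refine ⟨b - a, D.sub_mem hb ha, ?_, by simpa using e⟩
      have hneg : |chi (-a)| = |chi a| := by rw [chi_neg, abs_neg]
      have h1 : d = -a + (d + a) := by abel
      rw [h1, sub_eq_neg_add, chi_add_of_abs_chi_lt (hneg ▸ e ▸ h'),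
        chi_add_of_abs_chi_lt (hneg ▸ h')]
    · have ha0 : a ≠ 0 := by
        rintro rfl
        rw [chi_zero, abs_zero, abs_eq_zero, chi_eq_zero] at h
        exact hd (h ▸ D.zero_mem)
      rcases abs_eq_abs.1 h with h1 | h1
      · rcases abs_eq_abs.1 h' with h2 | h2
        · refine ⟨a, ha, h1.symm, ?_⟩
          rw [h2, ← two_nsmul, chi_nsmul two_ne_zero]
        · exact absurd h2 (chi_add_ne_neg ha0 h1)
      · rcases abs_eq_abs.1 h' with h2 | h2
        -- Opposite signs, with the sum on the side of `a`: minus half of `a` behaves like `d`.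
        · obtain ⟨b, hb, rfl⟩ := hhalf a ha
          rw [chi_nsmul two_ne_zero] at h1 h2
          refine ⟨-b, D.neg_mem hb, by rw [h1, chi_neg], ?_⟩
          rw [h2, two_nsmul, neg_add_cancel_left]
        -- Opposite signs, with the sum on the side of `d`: `-2a` behaves like `d`.
        · refine ⟨-(2 • a), D.neg_mem (D.nsmul_mem ha 2), ?_, ?_⟩
          · rw [h1, chi_neg, chi_nsmul two_ne_zero]
          · rw [h2, two_nsmul, ← chi_neg]
            congr 1
            abel
    -- Impossible: `d + a` would dominate `-a`, so `d` would have the same χ-value as `d + a`.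
    · have h1 : |chi (-a)| < |chi (d + a)| := by rwa [chi_neg, abs_neg]
      have h2 := chi_add_of_abs_chi_lt h1
      rw [add_neg_cancel_right] at h2
      rw [← h2, h] at h'
      exact absurd h' (lt_irrefl _)
  · obtain ⟨b, hb, e⟩ := hfib d
    refine ⟨b, hb, e, ?_⟩
    rw [chi_add_of_abs_chi_lt h, chi_add_of_abs_chi_lt (e ▸ h), e]

lemma exists_approx_finset {D : AddSubgroup G} (hfib : ∀ z, ∃ a ∈ D, chi a = chi z)
    (hhalf : ∀ a ∈ D, ∃ b ∈ D, 2 • b = a) {d : G} (hd : d ∉ D) {ι : Type*} (F : Finset ι)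
    (a : ι → G) (ha : ∀ i, a i ∈ D) : ∃ b ∈ D, ∀ i ∈ F, chi (b + a i) = chi (d + a i) := by
  rcases F.eq_empty_or_nonempty with rfl | hF
  · exact ⟨0, D.zero_mem, by simp⟩
  refine exists_mem_of_pairwise (D := D) hF
    (fun i => ordConnected_chi_fiber (a i) (chi (d + a i))) fun i _ j _ => ?_
  have hd' : d + a i ∉ D := fun h => hd (by simpa using D.sub_mem h (ha i))
  -- Translating by `a i` turns the two conditions into those at 0 and `a j - a i`.
  obtain ⟨b, hb, h1, h2⟩ := exists_approx hfib hhalf (D.sub_mem (ha j) (ha i)) hd'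
  refine ⟨b - a i, D.sub_mem hb (ha i), by simpa using h1, ?_⟩
  have e1 : b - a i + a j = b + (a j - a i) := by abel
  have e2 : d + a j = d + a i + (a j - a i) := by abel
  rw [Set.mem_ofPred_eq, e1, e2, h2]

end Approx

/-- Saturation for the two kinds of types needed to extend partial isomorphisms, the types being
indexed by `ι`. -/
structure RealizesTypes (ι G : Type*) [PdgGroup G] : Prop where
  exists_chi_add_eq : ∀ a b : ι → G, (∀ F : Finset ι, ∃ z, ∀ i ∈ F, chi (z + a i) = b i) →
    ∃ z, ∀ i, chi (z + a i) = b i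
  exists_mem_Psi : ∀ l r : ι → G,
    (∀ F : Finset ι, ∃ z ∈ Psi G, ∀ i ∈ F, l i < z ∧ z < r i) →
    ∃ z ∈ Psi G, ∀ i, l i < z ∧ z < r i

lemma RealizesTypes.of_surjective {ι ι' G : Type*} [PdgGroup G] (h : RealizesTypes ι G)
    {f : ι → ι'} (hf : Function.Surjective f) : RealizesTypes ι' G := by
  classical
  constructor
  · intro a b hab
    obtain ⟨z, hz⟩ := h.exists_chi_add_eq (a ∘ f) (b ∘ f) fun F => by
      obtain ⟨z, hz⟩ := hab (F.image f)
      exact ⟨z, fun i hi => hz _ (Finset.mem_image_of_mem f hi)⟩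
    exact ⟨z, hf.forall.2 hz⟩
  · intro l r hlr
    obtain ⟨z, hz, h'⟩ := h.exists_mem_Psi (l ∘ f) (r ∘ f) fun F => by
      obtain ⟨z, hz, h'⟩ := hlr (F.image f)
      exact ⟨z, hz, fun i hi => h' _ (Finset.mem_image_of_mem f hi)⟩
    exact ⟨z, hz, hf.forall.2 h'⟩

section Extension

variable {G G' : Type*} [PdgGroup G] [PdgGroup G'] {H : AddSubgroup (G × G')}

lemma IsPartialIso.exists_nsmul_eq (hH : IsPartialIso H) {n : ℕ} (hn : n ≠ 0) {p : G × G'}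
    (hp : p ∈ H) : ∃ q ∈ H, n • q = p := by
  obtain ⟨a, ha⟩ := PdgGroup.exists_nsmul_eq n p.1 hn
  obtain ⟨b, hb⟩ := PdgGroup.exists_nsmul_eq n p.2 hn
  have e : n • (a, b) = p := Prod.ext ha hb
  exact ⟨(a, b), hH.mem_of_nsmul_mem n _ hn (e ▸ hp), e⟩

/-- Up to sign, a nonzero value of χ is `c` or has a predecessor in Ψ, which lies in the domain by
`hPsi`. -/
lemma IsPartialIso.exists_chi_eq (hH : IsPartialIso H) (hPsi : ∀ b ∈ Psi G, ∃ p ∈ H, p.1 = b)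
    (d : G) : ∃ p ∈ H, chi p.1 = chi d := by
  have key : ∀ d : G, d < 0 → ∃ p ∈ H, chi p.1 = chi d := by
    intro d hd
    by_cases hc : chi d = c
    · obtain ⟨p, hp, -, h, -⟩ := hH.exists_chi_eq_c
      exact ⟨p, hp, h.trans hc.symm⟩
    · obtain ⟨b, hb, e⟩ := PdgGroup.exists_pred (chi_mem_Psi hd) hc
      obtain ⟨p, hp, rfl⟩ := hPsi b hb
      exact ⟨p, hp, e⟩
  rcases lt_trichotomy d 0 with h | rfl | h
  · exact key d h
  · exact ⟨0, H.zero_mem, rfl⟩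
  · obtain ⟨p, hp, e⟩ := key (-d) (by simpa using h)
    exact ⟨-p, H.neg_mem hp, by simpa [chi_neg, neg_eq_iff_eq_neg] using e⟩

/-- By divisibility `h + n d = n (q + d)` with `q` in `H`, so χ sends all of `H + ℤd` into `H`.
Signs are read off from these values, and no new elements of Ψ arise. -/
lemma IsPartialIso.exists_extension_of_chi_mem (hH : IsPartialIso H)
    (hPsi : ∀ b ∈ Psi G, ∃ p ∈ H, p.1 = b) (d : G × G')
    (hd : ∀ h ∈ H, (chi (d.1 + h.1), chi (d.2 + h.2)) ∈ H) :
    ∃ H', IsPartialIso H' ∧ H ≤ H' ∧ d ∈ H' := by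
  have key : ∀ n : ℕ, ∀ h ∈ H, (chi (h.1 + n • d.1), chi (h.2 + n • d.2)) ∈ H := by
    intro n h hh
    by_cases hn : n = 0
    · simpa [hn] using hH.chi_mem h hh
    · obtain ⟨q, hq, rfl⟩ := hH.exists_nsmul_eq hn hh
      rw [Prod.smul_fst, Prod.smul_snd, ← nsmul_add, ← nsmul_add, chi_nsmul hn, chi_nsmul hn,
        add_comm, add_comm q.2]
      exact hd q hq
  have hchi : ∀ p ∈ H ⊔ AddSubgroup.zmultiples d, (chi p.1, chi p.2) ∈ H := by
    intro p hp
    obtain ⟨h, hh, z, hz, rfl⟩ := AddSubgroup.mem_sup.1 hp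
    obtain ⟨m, rfl⟩ := AddSubgroup.mem_zmultiples_iff.1 hz
    obtain ⟨n, rfl | rfl⟩ := m.eq_nat_or_neg
    · simpa using key n h hh
    · have := H.neg_mem (key n (-h) (H.neg_mem hh))
      simpa [← chi_neg, add_comm] using this
  refine ⟨PdgGroup.pureClosure (H ⊔ AddSubgroup.zmultiples d), hH.pureClosure le_sup_left ?_
    (fun p hp => le_sup_left (a := H) (hchi p hp)) ?_, le_sup_left.trans (le_pureClosure _),
    le_pureClosure _ (le_sup_right (a := H) (AddSubgroup.mem_zmultiples d))⟩
  · intro p hp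
    rw [← chi_neg_iff, ← chi_neg_iff (a := p.2)]
    exact hH.neg_iff _ (hchi p hp)
  · rintro p ⟨n, hn, hp⟩ h1 h2
    left
    obtain ⟨q, hq, e⟩ := hPsi _ h1
    have h3 := hchi _ hp
    rw [Prod.smul_fst, Prod.smul_snd, chi_nsmul hn, chi_nsmul hn] at h3
    have h4 := hH.eq_of_fst_eq h3 (hH.chi_mem q hq) (by simp [e])
    exact hH.mem_of_chi_eq hq h1 h2 (by rw [e]) (congrArg Prod.snd h4)

/-- The type to realize prescribes `χ(d' + h')` for all `h` in `H`; each finite part is already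
satisfied by the second coordinate of an element of `H`. -/
lemma IsPartialIso.exists_extension_of_Psi_subset (hH : IsPartialIso H)
    (hG' : RealizesTypes H G') (hPsi : ∀ b ∈ Psi G, ∃ p ∈ H, p.1 = b) {d : G}
    (hd : ∀ p ∈ H, p.1 ≠ d) : ∃ H', IsPartialIso H' ∧ H ≤ H' ∧ ∃ p ∈ H', p.1 = d := by
  have hchi : ∀ h : H, ∃ q ∈ H, q.1 = chi (d + h.1.1) := by
    intro h
    obtain ⟨p, hp, e⟩ := hH.exists_chi_eq hPsi (d + h.1.1)
    exact ⟨_, hH.chi_mem p hp, e⟩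
  choose q hq hqe using hchi
  obtain ⟨d', hd'⟩ := hG'.exists_chi_add_eq (fun h => h.1.2) (fun h => (q h).2) fun F => by
    have hfib : ∀ z, ∃ a ∈ H.map (AddMonoidHom.fst G G'), chi a = chi z := by
      intro z
      obtain ⟨p, hp, e⟩ := hH.exists_chi_eq hPsi z
      exact ⟨p.1, ⟨p, hp, rfl⟩, e⟩
    have hhalf : ∀ a ∈ H.map (AddMonoidHom.fst G G'), ∃ b ∈ H.map (AddMonoidHom.fst G G'),
        2 • b = a := by
      rintro _ ⟨p, hp, rfl⟩
      obtain ⟨r, hr, rfl⟩ := hH.exists_nsmul_eq two_ne_zero hp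
      exact ⟨r.1, ⟨r, hr, rfl⟩, rfl⟩
    have hd0 : d ∉ H.map (AddMonoidHom.fst G G') := by
      rintro ⟨p, hp, e⟩
      exact hd p hp e
    obtain ⟨b, ⟨p, hp, rfl⟩, h⟩ := exists_approx_finset hfib hhalf hd0 F (fun h => h.1.1)
      fun h => ⟨h.1, h.2, rfl⟩
    refine ⟨p.2, fun i hi => ?_⟩
    refine (hH.fst_eq_iff (hH.chi_mem _ (H.add_mem hp i.2)) (hq i)).1 ?_
    rw [hqe]
    exact h i hi
  obtain ⟨H', h1, h2, h3⟩ := hH.exists_extension_of_chi_mem hPsi (d, d') fun h hh => by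
    have := hd' ⟨h, hh⟩
    dsimp only at this ⊢
    rw [this, ← hqe ⟨h, hh⟩]
    exact hq ⟨h, hh⟩
  exact ⟨H', h1, h2, _, h3, rfl⟩

end Extension

end PdgGroup

/-! ### Extension by a χ-orbit in Ψ, and total extensions -/

namespace PdgGroup

lemma mk_zsmul {G : Type*} [PdgGroup G] {m : ℤ} (hm : m ≠ 0) (a : G) :
    ArchimedeanClass.mk (m • a) = ArchimedeanClass.mk a := by
  obtain ⟨n, rfl | rfl⟩ := m.eq_nat_or_neg
  · rw [natCast_zsmul]
    exact mk_nsmul (by simpa using hm) a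
  · rw [neg_zsmul, natCast_zsmul, ArchimedeanClass.mk_neg]
    exact mk_nsmul (by simpa using hm) a

section Cut

variable {G G' : Type*} [PdgGroup G] [PdgGroup G']

/-- The two coordinates of `p` realize corresponding cuts in the images of `χ`. -/
def Cut (H : AddSubgroup (G × G')) (p : G × G') : Prop :=
  ∀ b ∈ H, b.1 ∈ Psi G → b.2 ∈ Psi G' → (b.1 < p.1 ∧ b.2 < p.2) ∨ (p.1 < b.1 ∧ p.2 < b.2)

variable {H : AddSubgroup (G × G')}

lemma IsPartialIso.exists_cut (hH : IsPartialIso H) (hG' : RealizesTypes H G') {e : G}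
    (he : e ∈ Psi G) (hne : ∀ p ∈ H, p.1 ≠ e) : ∃ e' ∈ Psi G', Cut H (e, e') := by
  classical
  have hce : c < e := lt_of_le_of_ne (c_le_of_mem_Psi he) (hne _ hH.c_mem)
  obtain ⟨e', he', h⟩ := hG'.exists_mem_Psi
    -- The defaults `c` and 0 impose only `c < z < 0`. For finitely many conditions the witness is
    -- the successor of the greatest relevant element below `e`; including `c` ensures that one
    -- exists.
    (fun h => if h.1.1 ∈ Psi G ∧ h.1.1 < e then h.1.2 else c)
    (fun h => if h.1.1 ∈ Psi G ∧ e < h.1.1 then h.1.2 else 0) fun F => by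
      obtain ⟨m, hm, hmax⟩ := Finset.exists_max_image
        (insert (⟨(c, c), hH.c_mem⟩ : H) (F.filter fun h => h.1.1 ∈ Psi G ∧ h.1.1 < e))
        (fun h => h.1.1) ⟨_, Finset.mem_insert_self _ _⟩
      have hm' : m.1.1 ∈ Psi G ∧ m.1.1 < e := by
        rcases Finset.mem_insert.1 hm with rfl | hm
        · exact ⟨c_mem_Psi, hce⟩
        · exact (Finset.mem_filter.1 hm).2
      have hm2 := hH.snd_mem_Psi m.2 hm'.1
      have hlt : m.1.2 < chi m.1.2 := lt_chi _ (neg_of_mem_Psi hm2)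
      refine ⟨chi m.1.2, chi_mem_Psi (neg_of_mem_Psi hm2), fun i hi => ⟨?_, ?_⟩⟩
      · split_ifs with hi'
        · refine lt_of_le_of_lt ?_ hlt
          exact (hH.le_iff i.2 m.2).1
            (hmax i (Finset.mem_insert_of_mem (Finset.mem_filter.2 ⟨hi, hi'⟩)))
        · exact (c_le_of_mem_Psi hm2).trans_lt hlt
      · split_ifs with hi'
        · refine (hH.lt_iff (hH.chi_mem _ m.2) i.2).1 ?_
          exact (chi_le_of_lt hm'.1 he hm'.2).trans_lt hi'.2
        · exact chi_neg_iff.2 (neg_of_mem_Psi hm2)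
  refine ⟨e', he', fun b hb h1 h2 => ?_⟩
  have := h ⟨b, hb⟩
  rcases lt_or_gt_of_ne (hne b hb) with h' | h'
  · left
    exact ⟨h', by simpa [h1, h'] using this.1⟩
  · right
    exact ⟨h', by simpa [h1, h'] using this.2⟩

/-- An element of Ψ in `H` is `c`, which lies below all successors, or has a predecessor in `H` to
compare with `p`. -/
lemma IsPartialIso.cut_chi (hH : IsPartialIso H) {p : G × G'} (h1 : p.1 ∈ Psi G)
    (h2 : p.2 ∈ Psi G') (h : Cut H p) : Cut H (chi p.1, chi p.2) := by
  intro b hb hb1 hb2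
  by_cases hc : b.1 = c
  · left
    have hc' : b.2 = c := (hH.fst_eq_iff hb hH.c_mem).1 hc
    rw [hc, hc']
    exact ⟨c_lt_chi h1, c_lt_chi h2⟩
  · obtain ⟨q, hq, hq1, hq2, e1, e2⟩ := hH.exists_pred b hb hb1 hb2 hc
    rw [← e1, ← e2]
    exact (h q hq hq1 hq2).imp (fun h => ⟨chi_lt_chi hq1 h1 h.1, chi_lt_chi hq2 h2 h.2⟩)
      fun h => ⟨chi_lt_chi h1 hq1 h.1, chi_lt_chi h2 hq2 h.2⟩

lemma IsPartialIso.cut_of_cut_chi (hH : IsPartialIso H) {p : G × G'}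
    (h : Cut H (chi p.1, chi p.2)) : Cut H p := by
  intro b hb hb1 hb2
  exact (h _ (hH.chi_mem b hb) (chi_mem_Psi (neg_of_mem_Psi hb1))
    (chi_mem_Psi (neg_of_mem_Psi hb2))).imp
      (fun h => ⟨lt_of_chi_lt h.1, lt_of_chi_lt h.2⟩)
      fun h => ⟨lt_of_chi_lt h.1, lt_of_chi_lt h.2⟩

lemma Cut.ne_c (hH : IsPartialIso H) {p : G × G'} (h1 : p.1 ∈ Psi G)
    (h : Cut H p) : p.1 ≠ c ∧ p.2 ≠ c := by
  rcases h _ hH.c_mem c_mem_Psi c_mem_Psi with h | h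
  · exact ⟨h.1.ne', h.2.ne'⟩
  · exact absurd h.1 (c_le_of_mem_Psi h1).not_gt

/-- A pair of orbits of `χ` realizing corresponding cuts. -/
structure IsChain (H : AddSubgroup (G × G')) (E : ℤ → G × G') : Prop where
  fst_mem : ∀ k, (E k).1 ∈ Psi G
  snd_mem : ∀ k, (E k).2 ∈ Psi G'
  cut : ∀ k, Cut H (E k)
  chi_fst : ∀ k, chi (E k).1 = (E (k + 1)).1
  chi_snd : ∀ k, chi (E k).2 = (E (k + 1)).2

/-- Since `c` realizes no such cut, predecessors always exist: χ permutes the pairs realizing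
corresponding cuts, and its integer powers give the orbit. -/
lemma IsPartialIso.exists_isChain (hH : IsPartialIso H) {p : G × G'} (h1 : p.1 ∈ Psi G)
    (h2 : p.2 ∈ Psi G') (h : Cut H p) : ∃ E, IsChain H E ∧ E 0 = p := by
  let K := {p : G × G' // p.1 ∈ Psi G ∧ p.2 ∈ Psi G' ∧ Cut H p}
  let s : K → K := fun p => ⟨(chi p.1.1, chi p.1.2), chi_mem_Psi (neg_of_mem_Psi p.2.1),
    chi_mem_Psi (neg_of_mem_Psi p.2.2.1), hH.cut_chi p.2.1 p.2.2.1 p.2.2.2⟩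
  have hs : Function.Bijective s := by
    constructor
    · intro p q hpq
      have hpq' := Prod.ext_iff.1 (Subtype.ext_iff.1 hpq)
      exact Subtype.ext (Prod.ext (injOn_chi_Psi p.2.1 q.2.1 hpq'.1)
        (injOn_chi_Psi p.2.2.1 q.2.2.1 hpq'.2))
    · rintro ⟨p, h1, h2, h⟩
      obtain ⟨a, ha, ea⟩ := PdgGroup.exists_pred h1 (h.ne_c hH h1).1
      obtain ⟨b, hb, eb⟩ := PdgGroup.exists_pred h2 (h.ne_c hH h1).2
      have e : (chi a, chi b) = p := Prod.ext ea eb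
      refine ⟨⟨(a, b), ha, hb, hH.cut_of_cut_chi ?_⟩, Subtype.ext e⟩
      rw [← e] at h
      exact h
  let σ : Equiv.Perm K := Equiv.ofBijective s hs
  have hσ : ∀ k : ℤ, s ((σ ^ k) ⟨p, h1, h2, h⟩) = (σ ^ (k + 1)) ⟨p, h1, h2, h⟩ := by
    intro k
    rw [add_comm, zpow_add, zpow_one]
    rfl
  refine ⟨fun k => ((σ ^ k) ⟨p, h1, h2, h⟩).1, ⟨fun k => ((σ ^ k) ⟨p, h1, h2, h⟩).2.1,
    fun k => ((σ ^ k) ⟨p, h1, h2, h⟩).2.2.1, fun k => ((σ ^ k) ⟨p, h1, h2, h⟩).2.2.2,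
    fun k => ?_, fun k => ?_⟩, rfl⟩
  · rw [← hσ]
  · rw [← hσ]

namespace IsChain

variable {E : ℤ → G × G'}

lemma strictMono_fst (hE : IsChain H E) : StrictMono fun k => (E k).1 :=
  strictMono_int_of_lt_succ fun k => by
    rw [← hE.chi_fst]
    exact lt_chi _ (neg_of_mem_Psi (hE.fst_mem k))

lemma strictMono_snd (hE : IsChain H E) : StrictMono fun k => (E k).2 :=
  strictMono_int_of_lt_succ fun k => by
    rw [← hE.chi_snd]
    exact lt_chi _ (neg_of_mem_Psi (hE.snd_mem k))

/-- In both coordinates, `p` and `q` lie in different archimedean classes, in the same order. -/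
def MkLt (p q : G × G') : Prop :=
  ArchimedeanClass.mk p.1 < ArchimedeanClass.mk q.1 ∧
    ArchimedeanClass.mk p.2 < ArchimedeanClass.mk q.2

/-- For negative `b`, the cut condition at `E (k + 1)`, the image of `E k`, strictly separates it
from the image of `b`; different χ-values force different classes. -/
lemma mkLt_or_of_mem (hE : IsChain H E) (hH : IsPartialIso H) {b : G × G'} (hb : b ∈ H)
    (h0 : b.1 ≠ 0) (k : ℤ) : MkLt b (E k) ∨ MkLt (E k) b := by
  have key : ∀ b ∈ H, b.1 < 0 → MkLt b (E k) ∨ MkLt (E k) b := by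
    intro b hb hneg
    have hneg' := (hH.neg_iff b hb).1 hneg
    rcases hE.cut (k + 1) _ (hH.chi_mem b hb) (chi_mem_Psi hneg) (chi_mem_Psi hneg') with h | h
    · rw [← hE.chi_fst, ← hE.chi_snd] at h
      exact .inl ⟨mk_lt_mk_of_chi_lt (neg_of_mem_Psi (hE.fst_mem k)) h.1,
        mk_lt_mk_of_chi_lt (neg_of_mem_Psi (hE.snd_mem k)) h.2⟩
    · rw [← hE.chi_fst, ← hE.chi_snd] at h
      exact .inr ⟨mk_lt_mk_of_chi_lt hneg h.1, mk_lt_mk_of_chi_lt hneg' h.2⟩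
  rcases lt_or_gt_of_ne h0 with h | h
  · exact key b hb h
  · simpa [MkLt] using key (-b) (H.neg_mem hb) (by simpa using h)

lemma mkLt_of_lt (hE : IsChain H E) {i k : ℤ} (h : i < k) : MkLt (E i) (E k) := by
  constructor
  · refine mk_lt_mk_of_chi_lt (neg_of_mem_Psi (hE.fst_mem k)) ?_
    exact chi_lt_chi (hE.fst_mem i) (hE.fst_mem k) (hE.strictMono_fst h)
  · refine mk_lt_mk_of_chi_lt (neg_of_mem_Psi (hE.snd_mem k)) ?_
    exact chi_lt_chi (hE.snd_mem i) (hE.snd_mem k) (hE.strictMono_snd h)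

lemma mkLt_zsmul_left {m : ℤ} (hm : m ≠ 0) {p q : G × G'} : MkLt (m • p) q ↔ MkLt p q := by
  simp only [MkLt, Prod.smul_fst, Prod.smul_snd, mk_zsmul hm]

lemma mkLt_zsmul_right {m : ℤ} (hm : m ≠ 0) {p q : G × G'} : MkLt p (m • q) ↔ MkLt p q := by
  simp only [MkLt, Prod.smul_fst, Prod.smul_snd, mk_zsmul hm]

lemma mkLt_zsmul_zero (hE : IsChain H E) {m : ℤ} (hm : m ≠ 0) (k : ℤ) : MkLt (m • E k) 0 := by
  rw [mkLt_zsmul_left hm]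
  constructor
  · simpa [lt_top_iff_ne_top] using (neg_of_mem_Psi (hE.fst_mem k)).ne
  · simpa [lt_top_iff_ne_top] using (neg_of_mem_Psi (hE.snd_mem k)).ne

/-- Every nonzero linear combination has a dominant term. -/
lemma exists_dominant (hE : IsChain H E) (hH : IsPartialIso H) {h : G × G'} (hh : h ∈ H)
    (f : ℤ →₀ ℤ) : h + f.sum (fun k m => m • E k) = 0 ∨
      ∃ b, MkLt b (h + f.sum (fun k m => m • E k) - b) ∧
        (b ∈ H ∨ ∃ k ∈ f.support, ∃ m : ℤ, m ≠ 0 ∧ b = m • E k) := by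
  induction f using Finsupp.induction with
  | zero =>
    by_cases h0 : h = 0
    · simp [h0]
    · right
      refine ⟨h, ?_, .inl hh⟩
      simp only [Finsupp.sum_zero_index, add_zero, sub_self, MkLt, Prod.fst_zero, Prod.snd_zero,
        ArchimedeanClass.mk_zero, lt_top_iff_ne_top, ne_eq, ArchimedeanClass.mk_eq_top_iff]
      exact ⟨fun e => h0 (hH.eq_of_fst_eq hh H.zero_mem e),
        fun e => h0 (hH.eq_of_snd_eq hh H.zero_mem e)⟩
  | single_add k m f hk hm ih =>
    right
    have hsupp : (Finsupp.single k m + f).support = insert k f.support := by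
      rw [Finsupp.support_single_add hk hm, Finset.cons_eq_insert]
    have hsum : h + (Finsupp.single k m + f).sum (fun k m => m • E k) =
        h + f.sum (fun k m => m • E k) + m • E k := by
      rw [Finsupp.sum_add_index' (by simp) (by intros; rw [add_smul]),
        Finsupp.sum_single_index (by simp)]
      abel
    rw [hsum, hsupp]
    rcases ih with ih | ⟨b, hlt, hb⟩
    · refine ⟨m • E k, ?_, .inr ⟨k, Finset.mem_insert_self _ _, m, hm, rfl⟩⟩
      rw [ih, zero_add, sub_self]
      exact hE.mkLt_zsmul_zero hm k
    -- The old dominant term comes from `H` or from an index other than `k`, so its class differs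
    -- from that of the new term.
    · have hcmp : MkLt b (m • E k) ∨ MkLt (m • E k) b := by
        rw [mkLt_zsmul_left hm, mkLt_zsmul_right hm]
        rcases hb with hb | ⟨i, hi, n, hn, rfl⟩
        · refine hE.mkLt_or_of_mem hH hb ?_ k
          intro h0
          have := hlt.1
          rw [h0, ArchimedeanClass.mk_zero] at this
          exact not_top_lt this
        · rw [mkLt_zsmul_left hn, mkLt_zsmul_right hn]
          have hik : i ≠ k := fun e => hk (e ▸ hi)
          exact (lt_or_gt_of_ne hik).imp hE.mkLt_of_lt hE.mkLt_of_lt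
      rcases hcmp with hc | hc
      · refine ⟨b, ?_, hb.imp_right ?_⟩
        · rw [add_sub_right_comm]
          exact ⟨(lt_min hlt.1 hc.1).trans_le (ArchimedeanClass.min_le_mk_add _ _),
            (lt_min hlt.2 hc.2).trans_le (ArchimedeanClass.min_le_mk_add _ _)⟩
        · rintro ⟨i, hi, h⟩
          exact ⟨i, Finset.mem_insert_of_mem hi, h⟩
      · refine ⟨m • E k, ?_, .inr ⟨k, Finset.mem_insert_self _ _, m, hm, rfl⟩⟩
        rw [add_sub_cancel_right]
        exact ⟨(mk_eq_of_mk_lt hlt.1).symm ▸ hc.1, (mk_eq_of_mk_lt hlt.2).symm ▸ hc.2⟩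

/-- The subgroup generated by a partial isomorphism and a chain. -/
noncomputable def sup (H : AddSubgroup (G × G')) (E : ℤ → G × G') : AddSubgroup (G × G') :=
  H ⊔ (LinearMap.range (Finsupp.linearCombination ℤ E)).toAddSubgroup

lemma mem_sup_self (H : AddSubgroup (G × G')) (E : ℤ → G × G') (k : ℤ) : E k ∈ sup H E :=
  le_sup_right (a := H) ⟨Finsupp.single k 1, by simp⟩

lemma eq_zero_or_exists_of_mem_sup (hE : IsChain H E) (hH : IsPartialIso H) {p : G × G'}
    (hp : p ∈ sup H E) : p = 0 ∨ ∃ b, chi p.1 = chi b.1 ∧ chi p.2 = chi b.2 ∧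
      (b ∈ H ∨ ∃ k, b = E k ∨ b = -E k) := by
  obtain ⟨h, hh, z, ⟨f, rfl⟩, rfl⟩ := AddSubgroup.mem_sup.1 hp
  refine (hE.exists_dominant hH hh f).imp id ?_
  rintro ⟨b, hlt, hb⟩
  have h1 := chi_eq_of_mk_lt hlt.1
  have h2 := chi_eq_of_mk_lt hlt.2
  rcases hb with hb | ⟨k, -, m, hm, rfl⟩
  · exact ⟨b, h1, h2, .inl hb⟩
  · obtain ⟨n, rfl | rfl⟩ := m.eq_nat_or_neg
    · have hn : n ≠ 0 := by simpa using hm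
      rw [natCast_zsmul] at h1 h2
      exact ⟨E k, h1.trans (chi_nsmul hn _), h2.trans (chi_nsmul hn _), .inr ⟨k, .inl rfl⟩⟩
    · have hn : n ≠ 0 := by simpa using hm
      rw [neg_zsmul, natCast_zsmul, ← smul_neg] at h1 h2
      exact ⟨-E k, h1.trans (chi_nsmul hn _), h2.trans (chi_nsmul hn _), .inr ⟨k, .inr rfl⟩⟩

/-- Dominant terms determine signs and χ-values. An element of Ψ in the closure therefore has the
χ-value of an element of `H` or of some `E k`, and injectivity of χ on Ψ identifies it. -/
lemma isPartialIso_pureClosure (hE : IsChain H E) (hH : IsPartialIso H) :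
    IsPartialIso (PdgGroup.pureClosure (sup H E)) := by
  have hs1 : ∀ k, chi (E k).1 < 0 := fun k => chi_neg_iff.2 (neg_of_mem_Psi (hE.fst_mem k))
  have hs2 : ∀ k, chi (E k).2 < 0 := fun k => chi_neg_iff.2 (neg_of_mem_Psi (hE.snd_mem k))
  refine hH.pureClosure le_sup_left ?_ ?_ ?_
  · intro p hp
    rw [← chi_neg_iff, ← chi_neg_iff (a := p.2)]
    rcases hE.eq_zero_or_exists_of_mem_sup hH hp with rfl | ⟨b, e1, e2, hb⟩
    · simp
    · rw [e1, e2]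
      rcases hb with hb | ⟨k, rfl | rfl⟩
      · exact hH.neg_iff _ (hH.chi_mem b hb)
      · exact iff_of_true (hs1 k) (hs2 k)
      · simp only [Prod.fst_neg, Prod.snd_neg, chi_neg, Left.neg_neg_iff]
        exact iff_of_false (hs1 k).not_gt (hs2 k).not_gt
  · intro p hp
    rcases hE.eq_zero_or_exists_of_mem_sup hH hp with rfl | ⟨b, e1, e2, hb⟩
    · rw [Prod.fst_zero, Prod.snd_zero, chi_zero, chi_zero]
      exact (sup H E).zero_mem
    · rw [e1, e2]
      have hk : ∀ k, (chi (E k).1, chi (E k).2) ∈ sup H E := fun k => by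
        rw [hE.chi_fst, hE.chi_snd]
        exact mem_sup_self H E (k + 1)
      rcases hb with hb | ⟨k, rfl | rfl⟩
      · exact le_sup_left (a := H) (hH.chi_mem b hb)
      · exact hk k
      · simpa [chi_neg] using (sup H E).neg_mem (hk k)
  · rintro p ⟨n, hn, hp⟩ h1 h2
    rcases hE.eq_zero_or_exists_of_mem_sup hH hp with h | ⟨b, e1, e2, hb⟩
    · have h' := congrArg Prod.fst h
      have := nsmul_neg (neg_of_mem_Psi h1) hn
      rw [Prod.smul_fst] at h'
      exact absurd h' this.ne
    · rw [Prod.smul_fst, chi_nsmul hn] at e1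
      rw [Prod.smul_snd, chi_nsmul hn] at e2
      rcases hb with hb | ⟨k, rfl | rfl⟩
      · exact .inl (hH.mem_of_chi_eq hb h1 h2 e1 e2)
      · right
        refine ⟨E (k - 1), mem_sup_self H E _, hE.fst_mem _, hE.snd_mem _, ?_, ?_⟩
        · rw [hE.chi_fst, sub_add_cancel]
          exact (injOn_chi_Psi h1 (hE.fst_mem k) e1).symm
        · rw [hE.chi_snd, sub_add_cancel]
          exact (injOn_chi_Psi h2 (hE.snd_mem k) e2).symm
      -- A dominant term `-E k` would make the element positive, but Ψ is negative.
      · have h3 := chi_neg_iff.2 (neg_of_mem_Psi h1)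
        rw [e1, Prod.fst_neg, chi_neg, Left.neg_neg_iff] at h3
        exact absurd h3 (hs1 k).not_gt

end IsChain

lemma IsPartialIso.exists_extension_of_mem_Psi (hH : IsPartialIso H) (hG' : RealizesTypes H G')
    {e : G} (he : e ∈ Psi G) (hne : ∀ p ∈ H, p.1 ≠ e) :
    ∃ H', IsPartialIso H' ∧ H ≤ H' ∧ ∃ p ∈ H', p.1 = e := by
  obtain ⟨e', he', hcut⟩ := hH.exists_cut hG' he hne
  obtain ⟨E, hE, hE0⟩ := hH.exists_isChain he he' hcut
  refine ⟨_, hE.isPartialIso_pureClosure hH, le_sup_left.trans (le_pureClosure _), E 0,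
    le_pureClosure _ (IsChain.mem_sup_self H E 0), ?_⟩
  rw [hE0]

/-- A partial isomorphism into a saturated model extends to the whole source. -/
theorem IsPartialIso.exists_total_extension (hH : IsPartialIso H) (hG' : RealizesTypes G G') :
    ∃ H', IsPartialIso H' ∧ H ≤ H' ∧ ∀ d, ∃ p ∈ H', p.1 = d := by
  obtain ⟨M, hHM, hM⟩ := zorn_le_nonempty₀ {H : AddSubgroup (G × G') | IsPartialIso H}
    (fun C hC hchain H₀ hH₀ => by
      have hdir : DirectedOn (· ≤ ·) C := hchain.directedOn
      have hmem : ∀ p, p ∈ sSup C ↔ ∃ K ∈ C, p ∈ K := fun p =>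
        AddSubgroup.mem_sSup_of_directedOn ⟨H₀, hH₀⟩ hdir
      refine ⟨sSup C, ⟨?_, ?_, ?_, ?_, ?_⟩, fun K hK => le_sSup hK⟩
      · intro p hp
        obtain ⟨K, hK, hp⟩ := (hmem p).1 hp
        exact (hC hK).neg_iff p hp
      · intro p hp
        obtain ⟨K, hK, hp⟩ := (hmem p).1 hp
        exact (hmem _).2 ⟨K, hK, (hC hK).chi_mem p hp⟩
      · obtain ⟨p, hp, h⟩ := (hC hH₀).exists_chi_eq_c
        exact ⟨p, (hmem p).2 ⟨H₀, hH₀, hp⟩, h⟩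
      · intro n p hn hp
        obtain ⟨K, hK, hp⟩ := (hmem _).1 hp
        exact (hmem _).2 ⟨K, hK, (hC hK).mem_of_nsmul_mem n p hn hp⟩
      · intro p hp h1 h2 hc
        obtain ⟨K, hK, hp⟩ := (hmem _).1 hp
        obtain ⟨q, hq, h⟩ := (hC hK).exists_pred p hp h1 h2 hc
        exact ⟨q, (hmem _).2 ⟨K, hK, hq⟩, h⟩) H hH
  have hMiso : IsPartialIso M := hM.prop
  refine ⟨M, hMiso, hHM, fun d => ?_⟩
  have hinj : Function.Injective fun p : M => p.1.1 := fun p q h =>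
    Subtype.ext (hMiso.eq_of_fst_eq p.2 q.2 h)
  -- `M` injects into `G` by the first coordinate, so types indexed by `M` are covered by those
  -- indexed by `G`.
  have hsat : RealizesTypes M G' := hG'.of_surjective (Function.invFun_surjective hinj)
  have hmax : ∀ a : G, (∃ H', IsPartialIso H' ∧ M ≤ H' ∧ ∃ p ∈ H', p.1 = a) →
      ∃ p ∈ M, p.1 = a := by
    rintro a ⟨H', h1, h2, p, hp, e⟩
    exact ⟨p, hM.le_of_ge h1 h2 hp, e⟩
  have hPsi : ∀ b ∈ Psi G, ∃ p ∈ M, p.1 = b := by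
    intro b hb
    by_contra! h
    obtain ⟨p, hp, e⟩ := hmax b (hMiso.exists_extension_of_mem_Psi hsat hb h)
    exact h p hp e
  by_contra! h
  obtain ⟨p, hp, e⟩ := hmax d (hMiso.exists_extension_of_Psi_subset hsat hPsi h)
  exact h p hp e

end Cut

end PdgGroup

/-! ### Models of the theory as ordered groups -/

namespace Pdg

section Semantics
variable {M : Type u} [Lpdg.Structure M]

variable (M) in
/-- The interpretation of `0`. -/
def zeroM : M := Structure.funMap (L := Lpdg) Func.zero ![]

/-- The interpretation of `-`. -/
def negM (a : M) : M := Structure.funMap (L := Lpdg) Func.neg ![a]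

/-- The interpretation of `+`. -/
def addM (a b : M) : M := Structure.funMap (L := Lpdg) Func.add ![a, b]

/-- The interpretation of `χ`. -/
def chiM (a : M) : M := Structure.funMap (L := Lpdg) Func.chi ![a]

variable (M) in
/-- The interpretation of `c`. -/
def cM : M := Structure.funMap (L := Lpdg) Func.c ![]

/-- The interpretation of `<`. -/
def ltM (a b : M) : Prop := Structure.RelMap (L := Lpdg) Rel.lt ![a, b]

/-- The `k`-fold sum of `a`. -/
def mulM : ℕ → M → M
  | 0, _ => zeroM M
  | k + 1, a => addM (mulM k a) a

variable {α : Type v} (e : α → M)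

@[simp] lemma realize_zero : (0 : Lpdg.Term α).realize e = zeroM M :=
  congrArg _ (funext fun i => i.elim0)

@[simp] lemma realize_c : (c : Lpdg.Term α).realize e = cM M :=
  congrArg _ (funext fun i => i.elim0)

@[simp] lemma realize_neg (t : Lpdg.Term α) : (-t).realize e = negM (t.realize e) :=
  Term.realize_functions_apply₁

@[simp] lemma realize_chi (t : Lpdg.Term α) : (chi t).realize e = chiM (t.realize e) :=
  Term.realize_functions_apply₁

@[simp] lemma realize_add (s t : Lpdg.Term α) :
    (s + t).realize e = addM (s.realize e) (t.realize e) :=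
  Term.realize_functions_apply₂

@[simp] lemma realize_mul (k : ℕ) (t : Lpdg.Term α) :
    (mul k t).realize e = mulM k (t.realize e) := by
  induction k with
  | zero => exact realize_zero e
  | succ k ih => rw [mul, realize_add, ih, mulM]

variable {n : ℕ} {a : Empty → M} {b : Fin n → M}

@[simp] lemma realize_v (i : Fin n) : (v i).realize (Sum.elim a b) = b i := rfl

@[simp] lemma realize_eq (s t : Lpdg.Term (Empty ⊕ Fin n)) :
    (eq s t).Realize a b ↔ s.realize (Sum.elim a b) = t.realize (Sum.elim a b) :=
  BoundedFormula.realize_bdEqual _ _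

@[simp] lemma realize_lt (s t : Lpdg.Term (Empty ⊕ Fin n)) :
    (lt s t).Realize a b ↔ ltM (s.realize (Sum.elim a b)) (t.realize (Sum.elim a b)) :=
  BoundedFormula.realize_rel₂

@[simp] lemma realize_le (s t : Lpdg.Term (Empty ⊕ Fin n)) :
    (le s t).Realize a b ↔ ltM (s.realize (Sum.elim a b)) (t.realize (Sum.elim a b)) ∨
      s.realize (Sum.elim a b) = t.realize (Sum.elim a b) := by
  simp [le]

@[simp] lemma realize_inImage (i : Fin n) :
    (inImage i).Realize a b ↔ ∃ z, ltM z (zeroM M) ∧ chiM z = b i := by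
  simp [inImage]

lemma realize_all₁ {φ : Lpdg.BoundedFormula Empty 1} :
    M ⊨ all₁ φ ↔ ∀ p : M, φ.Realize default ![p] := by
  simp only [all₁, Sentence.Realize, Formula.Realize, BoundedFormula.realize_all]
  refine forall_congr' fun p => ?_
  rw [show (Fin.snoc default p : Fin 1 → M) = ![p] from funext fun i => by fin_cases i; rfl]

lemma realize_all₂ {φ : Lpdg.BoundedFormula Empty 2} :
    M ⊨ all₂ φ ↔ ∀ p q : M, φ.Realize default ![p, q] := by
  simp only [all₂, Sentence.Realize, Formula.Realize, BoundedFormula.realize_all]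
  refine forall₂_congr fun p q => ?_
  rw [show (Fin.snoc (Fin.snoc default p : Fin 1 → M) q : Fin 2 → M) = ![p, q] from
    funext fun i => by fin_cases i <;> rfl]

lemma realize_all₃ {φ : Lpdg.BoundedFormula Empty 3} :
    M ⊨ all₃ φ ↔ ∀ p q r : M, φ.Realize default ![p, q, r] := by
  simp only [all₃, Sentence.Realize, Formula.Realize, BoundedFormula.realize_all]
  refine forall₃_congr fun p q r => ?_
  rw [show (Fin.snoc (Fin.snoc (Fin.snoc default p : Fin 1 → M) q : Fin 2 → M) r : Fin 3 → M) =
    ![p, q, r] from funext fun i => by fin_cases i <;> rfl]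

lemma realize_ex₁ {φ : Lpdg.BoundedFormula Empty 1} :
    M ⊨ ex₁ φ ↔ ∃ p : M, φ.Realize default ![p] := by
  simp only [ex₁, Sentence.Realize, Formula.Realize, BoundedFormula.realize_ex]
  refine exists_congr fun p => ?_
  rw [show (Fin.snoc default p : Fin 1 → M) = ![p] from funext fun i => by fin_cases i; rfl]

end Semantics

section Theory

variable {M : Type u} [Lpdg.Structure M] [hM : M ⊨ Tpdg]

lemma addM_assoc (p q r : M) :
    addM (addM p q) r = addM p (addM q r) := by
  have h := realize_all₃.1 (hM.realize_of_mem addAssoc (by simp [Tpdg]))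
  simp at h
  exact h p q r

lemma addM_comm (p q : M) :
    addM p q = addM q p := by
  have h := realize_all₂.1 (hM.realize_of_mem addComm (by simp [Tpdg]))
  simp at h
  exact h p q

lemma addM_zeroM (p : M) :
    addM p (zeroM M) = p := by
  have h := realize_all₁.1 (hM.realize_of_mem addZero (by simp [Tpdg]))
  simp at h
  exact h p

lemma addM_negM (p : M) :
    addM p (negM p) = zeroM M := by
  have h := realize_all₁.1 (hM.realize_of_mem addNeg (by simp [Tpdg]))
  simp at h
  exact h p

lemma ltM_irrefl (p : M) :
    ¬ ltM p p := by
  have h := realize_all₁.1 (hM.realize_of_mem ltIrrefl (by simp [Tpdg]))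
  simp at h
  exact h p

lemma ltM_trans {p q r : M} (hpq : ltM p q) (hqr : ltM q r) :
    ltM p r := by
  have h := realize_all₃.1 (hM.realize_of_mem ltTrans (by simp [Tpdg]))
  simp at h
  exact h p q r hpq hqr

lemma ltM_total (p q : M) :
    (ltM p q ∨ p = q) ∨ ltM q p := by
  have h := realize_all₂.1 (hM.realize_of_mem ltTotal (by simp [Tpdg]))
  simp at h
  exact h p q

lemma addM_ltM_addM {p q : M} (hpq : ltM p q) (r : M) :
    ltM (addM p r) (addM q r) := by
  have h := realize_all₃.1 (hM.realize_of_mem addLt (by simp [Tpdg]))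
  simp at h
  exact h p q r hpq

lemma chiM_eq_zeroM (p : M) :
    chiM p = zeroM M ↔ p = zeroM M := by
  have h := realize_all₁.1 (hM.realize_of_mem chiZero (by simp [Tpdg]))
  simp at h
  exact h p

lemma chiM_mono {p q : M} (hpq : ltM p q ∨ p = q) :
    ltM (chiM p) (chiM q) ∨ chiM p = chiM q := by
  have h := realize_all₂.1 (hM.realize_of_mem chiMono (by simp [Tpdg]))
  simp at h
  exact h p q hpq

lemma chiM_negM (p : M) :
    chiM (negM p) = negM (chiM p) := by
  have h := realize_all₁.1 (hM.realize_of_mem chiNeg (by simp [Tpdg]))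
  simp at h
  exact h p

lemma exists_chiM_eq_cM :
    ∃ z : M, ltM z (zeroM M) ∧ chiM z = cM M := by
  have h := realize_ex₁.1 (hM.realize_of_mem cMem (by simp [Tpdg]))
  simp at h
  exact h

lemma cM_le_chiM {z : M} (hz : ltM z (zeroM M)) :
    ltM (cM M) (chiM z) ∨ cM M = chiM z := by
  have h := realize_all₁.1 (hM.realize_of_mem cLeast (by simp [Tpdg]))
  simp at h
  exact h z hz

lemma cM_ltM_chiM_chiM {z : M} (hz : ltM z (zeroM M)) :
    ltM (cM M) (chiM (chiM z)) := by
  have h := realize_all₁.1 (hM.realize_of_mem chiMapsTo (by simp [Tpdg]))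
  simp at h
  exact (h z hz).2

lemma chiM_chiM_inj {p q : M} (hp : ltM p (zeroM M)) (hq : ltM q (zeroM M))
    (e : chiM (chiM p) = chiM (chiM q)) :
    chiM p = chiM q := by
  have h := realize_all₂.1 (hM.realize_of_mem chiInj (by simp [Tpdg]))
  simp at h
  exact h _ _ p hp rfl q hq rfl e

lemma exists_chiM_chiM {z : M} (hz : ltM z (zeroM M)) (hc : ltM (cM M) (chiM z)) :
    ∃ a : M, ltM a (zeroM M) ∧ chiM (chiM a) = chiM z := by
  have h := realize_all₁.1 (hM.realize_of_mem chiSurj (by simp [Tpdg]))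
  simp at h
  exact h z hz hc

lemma chiM_chiM_le {p q : M} (hp : ltM p (zeroM M)) (hq : ltM q (zeroM M))
    (e : ltM (chiM p) (chiM q)) :
    ltM (chiM (chiM p)) (chiM q) ∨ chiM (chiM p) = chiM q := by
  have h := realize_all₂.1 (hM.realize_of_mem chiSucc (by simp [Tpdg]))
  simp at h
  exact (h _ _ p hp rfl q hq rfl e).2


lemma ltM_chiM {z : M} (h0 : z ≠ zeroM M) :
    ltM (negM (chiM z)) z ∨ ltM (negM (chiM z)) (negM z) := by
  have h := realize_all₁.1 (hM.realize_of_mem centripetal (by simp [Tpdg]))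
  simp [absLt] at h
  exact (h z h0).2

lemma exists_mulM_eq {k : ℕ} (hk : 1 ≤ k) (p : M) : ∃ q, mulM k q = p := by
  have h := realize_all₁.1 (hM.realize_of_mem (divisible k) (.inr ⟨k, hk, rfl⟩))
  simp at h
  exact h p

lemma chiM_eq_of_le {k : ℕ} (hk : 1 ≤ k) {p q : M} (hp : ltM (zeroM M) p) (hq : ltM (zeroM M) q)
    (hpq : ltM p (mulM k q) ∨ p = mulM k q) (hpq' : ltM (negM p) (mulM k q))
    (hqp : ltM q (mulM k p) ∨ q = mulM k p) (hqp' : ltM (negM q) (mulM k p)) :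
    chiM p = chiM q := by
  have h := realize_all₂.1 (hM.realize_of_mem (chiArch k) (.inl (.inr ⟨k, hk, rfl⟩)))
  simp [sameSign, absLe] at h
  exact h p q (.inl (.inl ⟨hp, hq⟩)) (.inl hpq) (.inl (.inl hpq')) (.inl hqp) (.inl (.inl hqp'))

variable (M)

/-- The group structure of a model. -/
noncomputable abbrev addCommGroupOfModel : AddCommGroup M :=
  letI : Add M := ⟨addM⟩
  letI : Zero M := ⟨zeroM M⟩
  letI : Neg M := ⟨negM⟩
  { add_assoc := addM_assoc
    zero_add := fun a => (addM_comm _ _).trans (addM_zeroM a)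
    add_zero := addM_zeroM
    nsmul := nsmulRec
    zsmul := zsmulRec
    neg_add_cancel := fun a => (addM_comm _ _).trans (addM_negM a)
    add_comm := addM_comm }

/-- The linear order of a model. -/
noncomputable abbrev linearOrderOfModel : LinearOrder M where
  le a b := ltM a b ∨ a = b
  lt := ltM
  le_refl a := .inr rfl
  le_trans a b d := by
    rintro (h | rfl) (h' | rfl)
    · exact .inl (ltM_trans h h')
    · exact .inl h
    · exact .inl h'
    · exact .inr rfl
  lt_iff_le_not_ge a b := by
    constructor
    · intro h
      refine ⟨.inl h, ?_⟩
      rintro (h' | rfl)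
      · exact ltM_irrefl _ (ltM_trans h h')
      · exact ltM_irrefl _ h
    · rintro ⟨h | rfl, h'⟩
      · exact h
      · exact absurd (.inr rfl) h'
  le_antisymm a b := by
    rintro (h | rfl) (h' | h')
    · exact absurd (ltM_trans h h') (ltM_irrefl _)
    · exact h'.symm
    · rfl
    · rfl
  le_total a b := by
    rcases ltM_total a b with h | h
    · exact .inl h
    · exact .inr (.inl h)
  toDecidableLE := Classical.decRel _

lemma isOrderedAddMonoid_of_model :
    @IsOrderedAddMonoid M (addCommGroupOfModel M).toAddCommMonoid
      (linearOrderOfModel M).toPartialOrder.toPreorder :=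
  letI := addCommGroupOfModel M
  letI := linearOrderOfModel M
  { add_le_add_left := fun a b hab d => by
      rcases hab with h | rfl
      · exact .inl (addM_ltM_addM h d)
      · exact .inr rfl }

noncomputable instance pdgGroupOfModel : PdgGroup M :=
  letI := addCommGroupOfModel M
  letI := linearOrderOfModel M
  haveI := isOrderedAddMonoid_of_model M
  have hmul : ∀ (k : ℕ) (a : M), mulM k a = k • a := fun k a => by
    induction k with
    | zero => rw [zero_nsmul]; rfl
    | succ k ih => rw [succ_nsmul, mulM, ih]; rfl
  { addCommGroupOfModel M, linearOrderOfModel M, isOrderedAddMonoid_of_model M with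
    chi := chiM
    c := cM M
    chi_eq_zero := chiM_eq_zeroM
    chi_mono := fun _ _ => chiM_mono
    chi_neg := chiM_negM
    chi_eq_of_le_nsmul := fun k a b ha hb hab hba => by
      -- The axiom scheme starts at `k = 1`; for `k = 0` the hypotheses are contradictory.
      have hk : 1 ≤ k := by
        rcases k with _ | k
        · rw [zero_nsmul] at hab
          exact absurd ha hab.not_gt
        · omega
      refine chiM_eq_of_le hk ha hb ?_ ?_ ?_ ?_
      · rw [hmul]
        exact hab
      · rw [hmul]
        exact (neg_lt_zero.2 ha).trans (ha.trans_le hab)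
      · rw [hmul]
        exact hba
      · rw [hmul]
        exact (neg_lt_zero.2 hb).trans (hb.trans_le hba)
    lt_chi := fun a ha => by
      have h : -chiM a < a ∨ -chiM a < -a := ltM_chiM ha.ne
      have h0 : chiM a ≤ 0 := by
        have h1 : chiM a ≤ chiM 0 := chiM_mono (.inl ha)
        exact h1.trans_eq ((chiM_eq_zeroM (zeroM M)).2 rfl)
      rcases h with h | h
      · exact absurd (h.trans ha) (not_lt.2 (neg_nonneg.2 h0))
      · exact neg_lt_neg_iff.1 h
    exists_chi_eq_c := exists_chiM_eq_cM
    c_le_chi := fun _ => cM_le_chiM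
    c_lt_chi_chi := fun _ => cM_ltM_chiM_chiM
    chi_chi_injOn := fun _ _ => chiM_chiM_inj
    exists_chi_chi := fun _ => exists_chiM_chiM
    chi_chi_le := fun _ _ => chiM_chiM_le
    exists_nsmul_eq := fun n a hn => by
      obtain ⟨b, hb⟩ := exists_mulM_eq (Nat.one_le_iff_ne_zero.2 hn) a
      exact ⟨b, (hmul n b).symm.trans hb⟩ }

lemma funMap_add (e : Fin 2 → M) :
    Structure.funMap (L := Lpdg) Func.add e = e 0 + e 1 :=
  congrArg _ (funext fun i => by fin_cases i <;> rfl)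

lemma funMap_neg (e : Fin 1 → M) : Structure.funMap (L := Lpdg) Func.neg e = -e 0 :=
  congrArg _ (funext fun i => by fin_cases i; rfl)

lemma funMap_chi (e : Fin 1 → M) :
    Structure.funMap (L := Lpdg) Func.chi e = PdgGroup.chi (e 0) :=
  congrArg _ (funext fun i => by fin_cases i; rfl)

lemma funMap_zero (e : Fin 0 → M) : Structure.funMap (L := Lpdg) Func.zero e = (0 : M) :=
  congrArg _ (funext fun i => i.elim0)

lemma funMap_c (e : Fin 0 → M) : Structure.funMap (L := Lpdg) Func.c e = (PdgGroup.c : M) :=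
  congrArg _ (funext fun i => i.elim0)

lemma relMap_lt (e : Fin 2 → M) :
    Structure.RelMap (L := Lpdg) Rel.lt e ↔ e 0 < e 1 :=
  iff_of_eq (congrArg _ (funext fun i => by fin_cases i <;> rfl))

end Theory

end Pdg

/-! ### Embeddings and transport of partial isomorphisms -/

namespace PdgGroup

section Hom

variable {A B G G' : Type*} [PdgGroup A] [PdgGroup B] [PdgGroup G] [PdgGroup G']

/-- Embeddings of ordered groups that preserve `χ` and `c`. -/
structure IsHom (f : A →+ B) : Prop where
  strictMono : StrictMono f
  map_chi : ∀ a, f (chi a) = chi (f a)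
  map_c : f c = c

lemma IsHom.neg_iff {f : A →+ B} (hf : IsHom f) {a : A} : f a < 0 ↔ a < 0 := by
  rw [← map_zero f, hf.strictMono.lt_iff_lt]

lemma IsHom.map_mem_Psi {f : A →+ B} (hf : IsHom f) {a : A} (h : a ∈ Psi A) : f a ∈ Psi B := by
  obtain ⟨z, hz, rfl⟩ := h
  exact ⟨f z, hf.neg_iff.2 hz, (hf.map_chi z).symm⟩

/-- Ψ is existentially defined, so this needs the axioms: `chi a` is not `c`, hence has a
predecessor in Ψ of `A`, whose image equals `f a` by injectivity. -/
lemma IsHom.mem_Psi_of_map {f : A →+ B} (hf : IsHom f) {a : A} (h : f a ∈ Psi B) :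
    a ∈ Psi A := by
  have ha : a < 0 := hf.neg_iff.1 (neg_of_mem_Psi h)
  have hc : chi a ≠ c := by
    intro e
    have := c_lt_chi h
    rw [← hf.map_chi, e, hf.map_c] at this
    exact lt_irrefl _ this
  obtain ⟨q, hq, e⟩ := exists_pred (chi_mem_Psi ha) hc
  have : f q = f a := injOn_chi_Psi (hf.map_mem_Psi hq) h (by rw [← hf.map_chi, e, hf.map_chi])
  rwa [← hf.strictMono.injective this]

lemma IsHom.isPartialIso_range {f : A →+ G} {g : A →+ G'} (hf : IsHom f) (hg : IsHom g) :
    IsPartialIso (f.prod g).range where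
  neg_iff := by
    rintro _ ⟨a, rfl⟩
    exact hf.neg_iff.trans hg.neg_iff.symm
  chi_mem := by
    rintro _ ⟨a, rfl⟩
    exact ⟨chi a, Prod.ext (hf.map_chi a) (hg.map_chi a)⟩
  exists_chi_eq_c := by
    obtain ⟨z, hz, e⟩ := exists_chi_eq_c (G := A)
    refine ⟨_, ⟨z, rfl⟩, hf.neg_iff.2 hz, ?_, ?_⟩
    · exact (hf.map_chi z).symm.trans (e ▸ hf.map_c)
    · exact (hg.map_chi z).symm.trans (e ▸ hg.map_c)
  mem_of_nsmul_mem := by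
    rintro n p hn ⟨a, ha⟩
    obtain ⟨b, rfl⟩ := exists_nsmul_eq n a hn
    rw [map_nsmul] at ha
    exact ⟨b, nsmul_right_injective hn ha⟩
  exists_pred := by
    rintro _ ⟨a, rfl⟩ h1 - hc
    have hc' : a ≠ c := by
      rintro rfl
      exact hc hf.map_c
    obtain ⟨b, hb, rfl⟩ := exists_pred (hf.mem_Psi_of_map h1) hc'
    exact ⟨_, ⟨b, rfl⟩, hf.map_mem_Psi hb, hg.map_mem_Psi hb, (hf.map_chi b).symm,
      (hg.map_chi b).symm⟩

/-- Together with `IsHom.isPartialIso_map`, this allows the source to be replaced by a countable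
submodel containing the domain, and the result to be carried back. -/
lemma IsHom.isPartialIso_comap {f : A →+ G} (hf : IsHom f) {H : AddSubgroup (G × G')}
    (hH : IsPartialIso H) (hsub : ∀ p ∈ H, ∃ a, f a = p.1) :
    IsPartialIso (H.comap (f.prodMap (AddMonoidHom.id G'))) where
  neg_iff p hp := hf.neg_iff.symm.trans (hH.neg_iff _ hp)
  chi_mem p hp := by
    have := hH.chi_mem _ hp
    rw [AddSubgroup.mem_comap]
    simpa [hf.map_chi] using this
  exists_chi_eq_c := by
    obtain ⟨p, hp, h, h1, h2⟩ := hH.exists_chi_eq_c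
    obtain ⟨a, ha⟩ := hsub p hp
    refine ⟨(a, p.2), ?_, hf.neg_iff.1 (ha ▸ h), ?_, h2⟩
    · rw [AddSubgroup.mem_comap]
      simpa [ha] using hp
    · exact hf.strictMono.injective (by rw [hf.map_chi, ha, h1, hf.map_c])
  mem_of_nsmul_mem n p hn hp := hH.mem_of_nsmul_mem n _ hn (by
    rw [← map_nsmul]
    exact hp)
  exists_pred p hp h1 h2 hc := by
    obtain ⟨q, hq, hq1, hq2, e1, e2⟩ := hH.exists_pred _ hp (hf.map_mem_Psi h1) h2
      fun e => hc (hf.strictMono.injective (e.trans hf.map_c.symm))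
    obtain ⟨a, ha⟩ := hsub q hq
    refine ⟨(a, q.2), ?_, hf.mem_Psi_of_map (ha ▸ hq1), hq2, ?_, e2⟩
    · rw [AddSubgroup.mem_comap]
      simpa [ha] using hq
    · exact hf.strictMono.injective (by rw [hf.map_chi, ha, e1]; rfl)

lemma IsHom.isPartialIso_map {f : A →+ G} (hf : IsHom f) {H : AddSubgroup (A × G')}
    (hH : IsPartialIso H) : IsPartialIso (H.map (f.prodMap (AddMonoidHom.id G'))) where
  neg_iff := by
    rintro _ ⟨p, hp, rfl⟩
    exact hf.neg_iff.trans (hH.neg_iff p hp)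
  chi_mem := by
    rintro _ ⟨p, hp, rfl⟩
    exact ⟨_, hH.chi_mem p hp, Prod.ext (hf.map_chi p.1) rfl⟩
  exists_chi_eq_c := by
    obtain ⟨p, hp, h, h1, h2⟩ := hH.exists_chi_eq_c
    exact ⟨_, ⟨p, hp, rfl⟩, hf.neg_iff.2 h, (hf.map_chi p.1).symm.trans (h1 ▸ hf.map_c), h2⟩
  mem_of_nsmul_mem := by
    rintro n p hn ⟨q, hq, e⟩
    obtain ⟨r, hr, rfl⟩ := hH.exists_nsmul_eq hn hq
    rw [map_nsmul] at e
    exact ⟨r, hr, nsmul_right_injective hn e⟩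
  exists_pred := by
    rintro _ ⟨p, hp, rfl⟩ h1 h2 hc
    have hc' : p.1 ≠ c := fun e => hc ((congrArg f e).trans hf.map_c)
    obtain ⟨q, hq, hq1, hq2, e1, e2⟩ := hH.exists_pred p hp (hf.mem_Psi_of_map h1) h2 hc'
    exact ⟨_, ⟨q, hq, rfl⟩, hf.map_mem_Psi hq1, hq2,
      (hf.map_chi q.1).symm.trans (congrArg f e1), e2⟩

end Hom

end PdgGroup

namespace Pdg

open PdgGroup

section Embedding

variable {A : Type u} {B : Type v} [Lpdg.Structure A] [Lpdg.Structure B] [A ⊨ Tpdg] [B ⊨ Tpdg]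

/-- The group homomorphism underlying an embedding of models. -/
noncomputable def toAddMonoidHom (f : A ↪[Lpdg] B) : A →+ B :=
  AddMonoidHom.mk' f fun a b => by
    have := f.map_fun Func.add ![a, b]
    rw [funMap_add, funMap_add] at this
    exact this

lemma isHom_toAddMonoidHom (f : A ↪[Lpdg] B) : IsHom (toAddMonoidHom f) where
  strictMono a b h := by
    have := f.map_rel Rel.lt ![a, b]
    rw [relMap_lt, relMap_lt] at this
    exact this.2 h
  map_chi a := by
    have := f.map_fun Func.chi ![a]
    rw [funMap_chi, funMap_chi] at this
    exact this
  map_c := by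
    have := f.map_fun Func.c ![]
    rw [funMap_c, funMap_c] at this
    exact this

lemma exists_embedding_of_isPartialIso {H : AddSubgroup (A × B)} (hH : IsPartialIso H)
    (htot : ∀ a, ∃ p ∈ H, p.1 = a) : ∃ f : A ↪[Lpdg] B, ∀ a, (a, f a) ∈ H := by
  have htot' : ∀ a, ∃ b, (a, b) ∈ H := fun a => by
    obtain ⟨p, hp, rfl⟩ := htot a
    exact ⟨p.2, hp⟩
  choose f hf using htot'
  have huniq : ∀ {a b}, (a, b) ∈ H → f a = b := fun {a b} h =>
    (hH.fst_eq_iff (hf a) h).1 rfl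
  refine ⟨⟨⟨f, fun a b h => (hH.fst_eq_iff (hf a) (hf b)).2 h⟩, ?_, ?_⟩, hf⟩
  · intro n F e
    cases F with
    | zero => rw [funMap_zero, funMap_zero]; exact huniq H.zero_mem
    | neg => rw [funMap_neg, funMap_neg]; exact huniq (H.neg_mem (hf _))
    | add => rw [funMap_add, funMap_add]; exact huniq (H.add_mem (hf _) (hf _))
    | chi => rw [funMap_chi, funMap_chi]; exact huniq (hH.chi_mem _ (hf _))
    | c => rw [funMap_c, funMap_c]; exact huniq hH.c_mem
  · intro n R e
    cases R with
    | lt =>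
      rw [relMap_lt, relMap_lt]
      exact (hH.lt_iff (hf _) (hf _)).symm

end Embedding

/-! ### Saturation and the two kinds of types -/

section Saturation

/-- Every finitely satisfiable set of instances of a formula `φ(a i, b i, z)` is realized. -/
def RealizesInstances (ι : Type*) (L : FirstOrder.Language.{x, y}) (M : Type*)
    [L.Structure M] : Prop :=
  ∀ (φ : L.Formula (Fin 3)) (a b : ι → M),
    (∀ F : Finset ι, ∃ z, ∀ i ∈ F, φ.Realize ![a i, b i, z]) → ∃ z, ∀ i, φ.Realize ![a i, b i, z]

/-- The formula `χ(z + a) = b`. -/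
noncomputable def chiAddFormula : Lpdg.Formula (Fin 3) :=
  Term.equal (chi (Term.var 2 + Term.var 0)) (Term.var 1)

/-- The formula saying that `z` is in the image of the negative cone under `χ` and
`a < z < b`. -/
noncomputable def cutFormula : Lpdg.Formula (Fin 3) :=
  (Relations.boundedFormula₂ (L := Lpdg) Rel.lt
      (Term.var (Sum.inr 0) : Lpdg.Term (Fin 3 ⊕ Fin 1)) 0 ⊓
    Term.bdEqual (chi (Term.var (Sum.inr 0))) (Term.var (Sum.inl 2))).ex ⊓
  (Relations.formula₂ (L := Lpdg) Rel.lt (Term.var 0 : Lpdg.Term (Fin 3)) (Term.var 2) ⊓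
    Relations.formula₂ (L := Lpdg) Rel.lt (Term.var 2 : Lpdg.Term (Fin 3)) (Term.var 1))

variable {M : Type u} [Lpdg.Structure M] [M ⊨ Tpdg]

lemma realize_chiAddFormula (e : Fin 3 → M) :
    chiAddFormula.Realize e ↔ PdgGroup.chi (e 2 + e 0) = e 1 := by
  rw [chiAddFormula, Formula.realize_equal, realize_chi, realize_add]
  rfl

lemma realize_cutFormula (e : Fin 3 → M) :
    cutFormula.Realize e ↔ e 2 ∈ Psi M ∧ e 0 < e 2 ∧ e 2 < e 1 := by
  rw [cutFormula, Formula.realize_inf, Formula.realize_inf]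
  refine and_congr ?_ (and_congr (Formula.realize_rel₂.trans (relMap_lt _ _))
    (Formula.realize_rel₂.trans (relMap_lt _ _)))
  rw [Formula.Realize, BoundedFormula.realize_ex]
  refine exists_congr fun z => ?_
  rw [BoundedFormula.realize_inf]
  refine and_congr ((BoundedFormula.realize_rel₂.trans (relMap_lt _ _)).trans ?_)
    ((BoundedFormula.realize_bdEqual _ _).trans ?_)
  · rw [realize_zero]
    rfl
  · rw [realize_chi]
    rfl

lemma RealizesInstances.realizesTypes {ι : Type*} (h : RealizesInstances ι Lpdg M) :
    RealizesTypes ι M where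
  exists_chi_add_eq a b hab := by
    have := h chiAddFormula a b
    simp only [realize_chiAddFormula] at this
    exact this hab
  exists_mem_Psi l r hlr := by
    have := h cutFormula l r
    simp only [realize_cutFormula] at this
    -- With no instances the formula does not force `z` into Ψ, so the empty index set is treated
    -- separately.
    rcases isEmpty_or_nonempty ι with hι | ⟨⟨i⟩⟩
    · obtain ⟨z, hz, -⟩ := hlr ∅
      exact ⟨z, hz, fun i => hι.elim i⟩
    · obtain ⟨z, hz⟩ := this fun F => by
        obtain ⟨z, hz, h⟩ := hlr F
        exact ⟨z, fun i hi => ⟨hz, h i hi⟩⟩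
      exact ⟨z, (hz i).1, fun i => (hz i).2⟩

lemma IsSaturated.realizesInstances {L : FirstOrder.Language.{x, y}} {M : Type v} [L.Structure M]
    {κ : Cardinal.{v}} (h : IsSaturated L κ M) {ι : Type u} [Infinite ι]
    (hι : Cardinal.lift.{v} #ι < Cardinal.lift.{u} κ) : RealizesInstances ι L M := by
  intro φ a b hab
  let A : Set M := Set.range a ∪ Set.range b
  have hA : #A < κ := by
    rw [← Cardinal.lift_lt.{v, u}]
    refine lt_of_le_of_lt ?_ hι
    have hinf : ℵ₀ ≤ Cardinal.lift.{v} #ι := by simp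
    calc Cardinal.lift.{u} #A ≤ Cardinal.lift.{u} (#(Set.range a) + #(Set.range b)) :=
          Cardinal.lift_le.2 (Cardinal.mk_union_le _ _)
      _ = Cardinal.lift.{u} #(Set.range a) + Cardinal.lift.{u} #(Set.range b) :=
          Cardinal.lift_add _ _
      _ ≤ Cardinal.lift.{v} #ι + Cardinal.lift.{v} #ι :=
          add_le_add Cardinal.mk_range_le_lift Cardinal.mk_range_le_lift
      _ = Cardinal.lift.{v} #ι := Cardinal.add_eq_self hinf
  let a' : ι → A := fun i => ⟨a i, .inl ⟨i, rfl⟩⟩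
  let b' : ι → A := fun i => ⟨b i, .inr ⟨i, rfl⟩⟩
  let ψ : ι → L[[A]].Formula Unit := fun i =>
    ((L.lhomWithConstants A).onFormula φ).subst
      ![(L.con (a' i)).term, (L.con (b' i)).term, Term.var ()]
  have hψ : ∀ i z, (ψ i).Realize (fun _ => z) ↔ φ.Realize ![a i, b i, z] := by
    intro i z
    rw [← LHom.realize_onFormula (L.lhomWithConstants A) φ]
    refine BoundedFormula.realize_subst.trans (iff_of_eq ?_)
    refine congrArg (fun e : Fin 3 → M => BoundedFormula.Realize _ e _) (funext fun j => ?_)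
    fin_cases j
    · exact Term.realize_con
    · exact Term.realize_con
    · rfl
  obtain ⟨z, hz⟩ := h A hA (Set.range ψ) fun F hF => by
    classical
    rw [← Set.image_univ, Finset.subset_set_image_iff] at hF
    obtain ⟨F, -, rfl⟩ := hF
    obtain ⟨z, hz⟩ := hab F
    refine ⟨z, fun χ hχ => ?_⟩
    obtain ⟨i, hi, rfl⟩ := Finset.mem_image.1 hχ
    exact (hψ i z).2 (hz i hi)
  exact ⟨z, fun i => (hψ i z).1 (hz _ ⟨i, rfl⟩)⟩

end Saturation

end Pdg

/-! ### Ultrapowers and back-and-forth -/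

namespace Pdg

open PdgGroup

section Ultrapower

variable {L : FirstOrder.Language.{x, y}} (M : Type u) [L.Structure M] [Nonempty M]

/-- The ultrapower of `M` by a nonprincipal ultrafilter on `ℕ`. -/
abbrev Ultrapower : Type u := ((Filter.hyperfilter ℕ : Ultrafilter ℕ) : Filter ℕ).Product fun _ => M

variable {M}

/-- The class of a sequence in the ultrapower. -/
noncomputable def ultrapowerMk (s : ℕ → M) : Ultrapower M := Quotient.mk _ s

lemma realize_ultrapowerMk {β : Type*} (φ : L.Formula β) (s : β → ℕ → M) :
    (φ.Realize fun i => ultrapowerMk (s i)) ↔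
      ∀ᶠ m in (Filter.hyperfilter ℕ : Ultrafilter ℕ), φ.Realize fun i => s i m :=
  Ultraproduct.realize_formula_cast φ s

lemma realize_ultrapowerMk₃ (φ : L.Formula (Fin 3)) (r s t : ℕ → M) :
    φ.Realize ![ultrapowerMk r, ultrapowerMk s, ultrapowerMk t] ↔
      ∀ᶠ m in (Filter.hyperfilter ℕ : Ultrafilter ℕ), φ.Realize ![r m, s m, t m] := by
  have h := realize_ultrapowerMk φ ![r, s, t]
  have h1 : (fun i => ultrapowerMk (![r, s, t] i)) =
      ![ultrapowerMk r, ultrapowerMk s, ultrapowerMk t] := by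
    funext i
    fin_cases i <;> rfl
  have h2 : ∀ m, (fun i => ![r, s, t] i m) = ![r m, s m, t m] := fun m => by
    funext i
    fin_cases i <;> rfl
  simpa only [h1, h2] using h

/-- The diagonal embedding into the ultrapower. -/
noncomputable def diagonal (L : FirstOrder.Language.{x, y}) (M : Type u) [L.Structure M]
    [Nonempty M] :
    M ↪ₑ[L] Ultrapower M where
  toFun a := ultrapowerMk fun _ => a
  map_formula' n φ e := by
    refine (realize_ultrapowerMk φ fun i _ => e i).trans ?_
    exact Filter.eventually_const

/-- Diagonalization: `t n` solves instances 0 to `n` at almost all coordinates. At coordinate `m`,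
use the largest `n ≤ m` for which `t n` solves them there; since the ultrafilter is nonprincipal,
this `n` is at least any fixed `k` almost everywhere. -/
lemma realizesInstances_ultrapower : RealizesInstances ℕ L (Ultrapower M) := by
  intro φ a b hab
  choose r hr using fun i => Quotient.exists_rep (a i)
  choose s hs using fun i => Quotient.exists_rep (b i)
  have hx : ∀ n : ℕ, ∃ t : ℕ → M, ∀ k ≤ n,
      ∀ᶠ m in (Filter.hyperfilter ℕ : Ultrafilter ℕ), φ.Realize ![r k m, s k m, t m] := by
    intro n
    obtain ⟨z, hz⟩ := hab (Finset.range (n + 1))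
    obtain ⟨t, rfl⟩ := Quotient.exists_rep z
    refine ⟨t, fun k hk => ?_⟩
    rw [← realize_ultrapowerMk₃]
    have := hz k (Finset.mem_range.2 (Nat.lt_succ_of_le hk))
    rw [← hr, ← hs] at this
    exact this
  choose t ht using hx
  let X : ℕ → ℕ → Prop := fun n m => ∀ k ≤ n, φ.Realize ![r k m, s k m, t n m]
  have hX : ∀ n, ∀ᶠ m in (Filter.hyperfilter ℕ : Ultrafilter ℕ), X n m ∧ n ≤ m := by
    intro n
    refine Filter.Eventually.and ?_ ?_
    · exact (Filter.eventually_all_finite (Set.finite_Iic n)).2 fun k hk => ht n k hk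
    · refine Filter.hyperfilter_le_cofinite ?_
      rw [Nat.cofinite_eq_atTop]
      exact Filter.eventually_ge_atTop n
  classical
  let N : ℕ → ℕ := fun m => Nat.findGreatest (fun n => X n m) m
  refine ⟨ultrapowerMk fun m => t (N m) m, fun k => ?_⟩
  rw [← hr, ← hs]
  refine (realize_ultrapowerMk₃ φ (r k) (s k) _).2 ((hX k).mono fun m hm => ?_)
  exact Nat.findGreatest_spec (P := fun n => X n m) hm.2 hm.1 k (Nat.le_findGreatest hm.2 hm.1)

end Ultrapower

section BackAndForth

lemma card_Lpdg_le : Lpdg.card ≤ ℵ₀ := by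
  have h1 : ∀ n, Countable (Lpdg.Functions n) := fun n => by
    have hinj : Function.Injective (fun F : Func n => match F with
      | .zero => 0
      | .neg => 1
      | .add => 2
      | .chi => 3
      | .c => (4 : ℕ)) := by
      intro F F' h
      cases F <;> cases F' <;> first | rfl | simp at h
    exact hinj.countable
  have h2 : ∀ n, Countable (Lpdg.Relations n) := fun n => by
    have : Subsingleton (Rel n) := ⟨by rintro ⟨⟩ ⟨⟩; rfl⟩
    exact (inferInstance : Countable (Rel n))
  have : Countable Lpdg.Symbols := inferInstanceAs (Countable (_ ⊕ _))
  exact Cardinal.mk_le_aleph0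

lemma exists_countable_elementarySubstructure {M : Type u} [Lpdg.Structure M] [Infinite M]
    {s : Set M} (hs : s.Countable) :
    ∃ S : Lpdg.ElementarySubstructure M, s ⊆ S ∧ Countable S := by
  obtain ⟨S, hS, hcard⟩ := exists_elementarySubstructure_card_eq Lpdg s Cardinal.aleph0.{u} le_rfl
    (by simpa using hs) (by simpa using card_Lpdg_le) (by simp)
  refine ⟨S, hS, ?_⟩
  rw [← Cardinal.mk_le_aleph0_iff]
  simpa using hcard.le

variable {M : Type u} {N : Type v} [Lpdg.Structure M] [Lpdg.Structure N] [M ⊨ Tpdg] [N ⊨ Tpdg]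

/-- Only countable types are realized in `N`, while `M` may be uncountable. The total extension is
therefore applied to a countable elementary substructure of `M` containing `d` and the domain of
`H`. -/
lemma exists_countable_extension (hN : RealizesTypes ℕ N) {H : AddSubgroup (M × N)}
    (hH : IsPartialIso H) (hc : Countable H) (d : M) :
    ∃ H' : AddSubgroup (M × N), IsPartialIso H' ∧ Countable H' ∧ H ≤ H' ∧
      ∃ p ∈ H', p.1 = d := by
  have : Infinite M := PdgGroup.infinite
  have hcs : (insert d (Prod.fst '' (H : Set (M × N)))).Countable :=
    ((Set.to_countable (H : Set (M × N))).image _).insert d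
  obtain ⟨S, hS, hScount⟩ := exists_countable_elementarySubstructure hcs
  let f : S →+ M := toAddMonoidHom S.subtype.toEmbedding
  have hf : IsHom f := isHom_toAddMonoidHom _
  have hH₀ := hf.isPartialIso_comap hH fun p hp =>
    ⟨⟨p.1, hS (Set.mem_insert_of_mem _ ⟨p, hp, rfl⟩)⟩, rfl⟩
  obtain ⟨g, hg⟩ := exists_surjective_nat S
  obtain ⟨K, hK, hHK, htot⟩ := hH₀.exists_total_extension (hN.of_surjective hg)
  have hKcount : Countable K := by
    refine Function.Injective.countable (f := fun p : K => p.1.1) fun p q h => ?_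
    exact Subtype.ext (hK.eq_of_fst_eq p.2 q.2 h)
  refine ⟨_, hf.isPartialIso_map hK, ?_, ?_, ?_⟩
  · exact ((Set.to_countable (K : Set (S × N))).image _).to_subtype
  · intro p hp
    exact ⟨(⟨p.1, hS (Set.mem_insert_of_mem _ ⟨p, hp, rfl⟩)⟩, p.2), hHK hp, rfl⟩
  · obtain ⟨p, hp, e⟩ := htot ⟨d, hS (Set.mem_insert _ _)⟩
    exact ⟨_, ⟨p, hp, rfl⟩, congrArg f e⟩

lemma realize_term_mem {H : AddSubgroup (M × N)} (hH : IsPartialIso H) {α : Type*}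
    {e : α → M × N} (he : ∀ i, e i ∈ H) (t : Lpdg.Term α) :
    (t.realize fun i => (e i).1, t.realize fun i => (e i).2) ∈ H := by
  induction t with
  | var i => exact he i
  | func F ts ih =>
    rw [Term.realize, Term.realize]
    cases F with
    | zero => rw [funMap_zero, funMap_zero]; exact H.zero_mem
    | neg => rw [funMap_neg, funMap_neg]; exact H.neg_mem (ih _)
    | add => rw [funMap_add, funMap_add]; exact H.add_mem (ih _) (ih _)
    | chi => rw [funMap_chi, funMap_chi]; exact hH.chi_mem _ (ih _)
    | c => rw [funMap_c, funMap_c]; exact hH.c_mem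

/-- Countable partial isomorphisms between saturated models preserve all formulas. -/
lemma realize_iff_of_isPartialIso (hM : RealizesTypes ℕ M) (hN : RealizesTypes ℕ N) {α : Type*}
    {n : ℕ} (φ : Lpdg.BoundedFormula α n) {H : AddSubgroup (M × N)} (hH : IsPartialIso H)
    (hc : Countable H) {e : α → M × N} (he : ∀ i, e i ∈ H) {b : Fin n → M × N}
    (hb : ∀ i, b i ∈ H) :
    φ.Realize (Prod.fst ∘ e) (Prod.fst ∘ b) ↔ φ.Realize (Prod.snd ∘ e) (Prod.snd ∘ b) := by
  have hterm : ∀ {n : ℕ} {H : AddSubgroup (M × N)} (_ : IsPartialIso H) (_ : ∀ i, e i ∈ H)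
      {b : Fin n → M × N} (_ : ∀ i, b i ∈ H) (t : Lpdg.Term (α ⊕ Fin n)),
      (t.realize (Sum.elim (Prod.fst ∘ e) (Prod.fst ∘ b)),
        t.realize (Sum.elim (Prod.snd ∘ e) (Prod.snd ∘ b))) ∈ H := by
    intro n H hH he b hb t
    rw [← Sum.comp_elim, ← Sum.comp_elim]
    exact realize_term_mem hH (e := Sum.elim e b) (by rintro (i | i); exacts [he i, hb i]) t
  induction φ generalizing H with
  | falsum => exact Iff.rfl
  | equal s t => exact hH.fst_eq_iff (hterm hH he hb s) (hterm hH he hb t)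
  | rel R ts =>
    cases R with
    | lt =>
      refine (relMap_lt M _).trans (Iff.trans ?_ (relMap_lt N _).symm)
      exact hH.lt_iff (hterm hH he hb (ts 0)) (hterm hH he hb (ts 1))
  | imp φ ψ ih₁ ih₂ =>
    rw [BoundedFormula.realize_imp, BoundedFormula.realize_imp]
    exact imp_congr (ih₁ hH hc he hb) (ih₂ hH hc he hb)
  | all φ ih =>
    rw [BoundedFormula.realize_all, BoundedFormula.realize_all]
    have step : ∀ {K : AddSubgroup (M × N)} (_ : IsPartialIso K) (_ : Countable K) (_ : H ≤ K)
        {p : M × N} (_ : p ∈ K), φ.Realize (Prod.fst ∘ e) (Fin.snoc (Prod.fst ∘ b) p.1) ↔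
          φ.Realize (Prod.snd ∘ e) (Fin.snoc (Prod.snd ∘ b) p.2) := by
      intro K hK hKc hHK p hp
      have := ih hK hKc (fun i => hHK (he i)) (b := Fin.snoc b p) fun i => by
        refine Fin.lastCases ?_ (fun i => ?_) i
        · simpa using hp
        · simpa using hHK (hb i)
      rwa [Fin.comp_snoc, Fin.comp_snoc] at this
    constructor
    · intro h z
      -- The back direction is the forth direction for the swapped partial isomorphism.
      have hcs : Countable (H.comap (AddEquiv.prodComm : N × M ≃+ M × N).toAddMonoidHom) := by
        refine Function.Injective.countable (f := fun p => (⟨p.1.swap, p.2⟩ : H)) fun p q h => ?_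
        exact Subtype.ext (Prod.swap_injective (congrArg Subtype.val h))
      obtain ⟨K, hK, hKc, hHK, p, hp, rfl⟩ := exists_countable_extension hM hH.symm hcs z
      have hKc' : Countable (K.comap (AddEquiv.prodComm : M × N ≃+ N × M).toAddMonoidHom) := by
        refine Function.Injective.countable (f := fun p => (⟨p.1.swap, p.2⟩ : K)) fun p q h => ?_
        exact Subtype.ext (Prod.swap_injective (congrArg Subtype.val h))
      exact (step hK.symm hKc' (fun q hq => hHK (x := q.swap) hq) (p := p.swap) hp).1 (h _)
    · intro h z
      obtain ⟨K, hK, hKc, hHK, p, hp, rfl⟩ := exists_countable_extension hN hH hc z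
      exact (step hK hKc hHK hp).2 (h _)

end BackAndForth

lemma isModelComplete_Tpdg : IsModelComplete.{u, v} Tpdg := by
  intro M N _ _ _ _ hM hN f n φ a
  have hM' : Ultrapower M ⊨ Tpdg := ((diagonal Lpdg M).theory_model_iff Tpdg).1 hM
  have hN' : Ultrapower N ⊨ Tpdg := ((diagonal Lpdg N).theory_model_iff Tpdg).1 hN
  have : Infinite M := PdgGroup.infinite
  -- The map from `S` to the ultrapower of `N` need not be elementary; an embedding of models is
  -- enough for a partial isomorphism.
  obtain ⟨S, hS, hScount⟩ := exists_countable_elementarySubstructure (Set.countable_range a)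
  let i : S ↪[Lpdg] Ultrapower M := ((diagonal Lpdg M).comp S.subtype).toEmbedding
  let j : S ↪[Lpdg] Ultrapower N :=
    ((diagonal Lpdg N).toEmbedding.comp f).comp S.subtype.toEmbedding
  have hH := (isHom_toAddMonoidHom i).isPartialIso_range (isHom_toAddMonoidHom j)
  have hc : Countable ((toAddMonoidHom i).prod (toAddMonoidHom j)).range :=
    (Set.countable_range _).to_subtype
  have key := realize_iff_of_isPartialIso realizesInstances_ultrapower.realizesTypes
    realizesInstances_ultrapower.realizesTypes φ hH hc
    (e := fun k => (diagonal Lpdg M (a k), diagonal Lpdg N (f (a k))))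
    (fun k => ⟨⟨a k, hS ⟨k, rfl⟩⟩, rfl⟩) (b := default) (fun k => k.elim0)
  rw [← (diagonal Lpdg M).map_formula φ a, ← (diagonal Lpdg N).map_formula φ (f ∘ a)]
  refine Iff.trans (iff_of_eq ?_) (key.symm.trans (iff_of_eq ?_))
  · exact congrArg (BoundedFormula.Realize φ _) (funext fun k => k.elim0)
  · exact congrArg (BoundedFormula.Realize φ _) (funext fun k => k.elim0)

end Pdg

theorem mainTheorem1 :
    (∀ (Γ' : Type u) [Pdg.Lpdg.Structure Γ'] (Γ : Pdg.Lpdg.Substructure Γ')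
        (Γs : Type v) [Pdg.Lpdg.Structure Γs] (κ : Cardinal.{v}) (j : Γ ↪ₑ[Pdg.Lpdg] Γs),
        Γ' ⊨ Pdg.Tpdg → Γ ⊨ Pdg.Tpdg → Γ ≠ ⊤ →
        Pdg.IsSaturated Pdg.Lpdg κ Γs →
        Cardinal.lift.{v} (Cardinal.mk Γ') < Cardinal.lift.{u} κ →
        ∃ (Δ : Pdg.Lpdg.Substructure Γ') (hΔ : Γ < Δ), Δ ⊨ Pdg.Tpdg ∧
          ∃ f : Δ ↪[Pdg.Lpdg] Γs, ∀ a : Γ, f ⟨a, hΔ.le a.2⟩ = j a) ∧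
    Pdg.IsModelComplete.{u, v} Pdg.Tpdg := by
  refine ⟨?_, Pdg.isModelComplete_Tpdg⟩
  intro Γ' _ Γ Γs _ κ j hΓ' hΓ hne hsat hκ
  have hΓs : Γs ⊨ Pdg.Tpdg := (j.theory_model_iff Pdg.Tpdg).1 hΓ
  have : Infinite Γ' := PdgGroup.infinite
  have hH := (Pdg.isHom_toAddMonoidHom Γ.subtype).isPartialIso_range
    (Pdg.isHom_toAddMonoidHom j.toEmbedding)
  obtain ⟨K, hK, hHK, htot⟩ :=
    hH.exists_total_extension (hsat.realizesInstances hκ).realizesTypes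
  obtain ⟨f, hf⟩ := Pdg.exists_embedding_of_isPartialIso hK htot
  -- The partial isomorphism extends to all of Γ', so Δ can be everything.
  refine ⟨⊤, hne.lt_top, ?_, f.comp (⊤ : Pdg.Lpdg.Substructure Γ').subtype, fun a => ?_⟩
  · exact StrongHomClass.theory_model Substructure.topEquiv.symm
  · exact (hK.fst_eq_iff (hf a) (hHK ⟨a, rfl⟩)).1 rfl
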